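/- Let $\Bbbk$ be a field. For a finite set $I$, a (nonempty) polyhedron $\mathfrak p\subset\mathbb R^I$ and $x\in\mathbb R^I$ let $\mathfrak p_x$ be the face of $\mathfrak p$ on which $y\mapsto x\cdot y$ is maximal (empty if the functional is unbounded above on $\mathfrak p$). The normal fan $\mathcal N(\mathfrak p)$ consists of the cones $\{x:\mathfrak p_x=\mathfrak q\}$, for the nonempty faces $\mathfrak q=\mathfrak p_{x_0}$ of $\mathfrak p$. The braid fan in $\mathbb R^I$ consists of the relatively open faces of the arrangement of the hyperplanes $x_i=x_j$. An \emph{extended generalized permutahedron} in $\mathbb R^I$ is a nonempty polyhedron whose normal fan coarsens a convex subfan of the braid fan. Let $\mathbf L^*$ be the Hopf monoid of linear orders: $\mathbf L^*[I]$ has the linear orders on $I$ as a basis, the product of $w$ and $u$ is the sum of all shuffles of $w$ and $u$, and $\Delta_{I,J}(v)=v|_I\otimes v|_J$ if $v|_I$ is an initial segment of $v$, and $0$ otherwise. Let $\mathbf{GP}_+$ be the Hopf monoid of extended generalized permutahedra: $\mathbf{GP}_+[I]$ has the extended generalized permutahedra in $\mathbb R^I$ as a basis, the product is $\mathfrak p_1\times\mathfrak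 p_2$, and for $\mathfrak p\subset\mathbb R^{I\sqcup J}$ one has $\Delta_{I,J}(\mathfrak p)=\mathfrak p|I\otimes\mathfrak p/I$ if $\mathfrak p$ is bounded above in the direction of the indicator vector $1_I$, where $\mathfrak p_{1_I}=\mathfrak p|I\times\mathfrak p/I$ with $\mathfrak p|I\subset\mathbb R^I$ and $\mathfrak p/I\subset\mathbb R^J$, and $\Delta_{I,J}(\mathfrak p)=0$ otherwise. In both cases the unit is the unique basis element over $\emptyset$, and the counit sends it to $1$. Let $\mathbf L^*\times\mathbf{GP}_+$ be the Hadamard product, $(\mathbf L^*\times\mathbf{GP}_+)[I]=\mathbf L^*[I]\otimes\mathbf{GP}_+[I]$ with componentwise operations. For a linear order $w$ on $I$ let $\sigma_w\subset\mathbb R^I$ be its braid chamber, the open cone of all $x$ whose coordinates strictly increase along $w$ ($x_i<x_j$ if and only if $i$ precedes $j$ in $w$). Let $\mathbf{OGP}_+[I]\subseteq(\mathbf L^*\times\mathbf{GP}_+)[I]$ be the subspace spanned by the tensors $w\otimes\mathfrak p$ such that $\sigma_w$ is contained in (the union of the cones of) $\mathcal N(\mathfrak p)$. \textbf{Theorem.}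 $\mathbf L^*\times\mathbf{GP}_+$ is a connected Hopf monoid in vector species, and $\mathbf{OGP}_+$ is a Hopf submonoid of it: it is closed under relabelling, contains the unit, and satisfies $\mathbf{OGP}_+[I]\cdot\mathbf{OGP}_+[J]\subseteq\mathbf{OGP}_+[I\sqcup J]$ and $\Delta_{I,J}(\mathbf{OGP}_+[I\sqcup J])\subseteq\mathbf{OGP}_+[I]\otimes\mathbf{OGP}_+[J]$ for all finite sets $I,J$. Moreover, if $\sigma_w$ is contained in $\mathcal N(\mathfrak p)$, then the set $\mathfrak p_w$ of the points of $\mathfrak p$ that maximize all functionals $y\mapsto x\cdot y$ with $x\in\sigma_w$ consists of a single point, which is a vertex of $\mathfrak p$. The same statements hold if instead $\sigma_w$ is taken to be the opposite chamber, consisting of all $x$ whose coordinates strictly decrease along $w$. -/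

import Mathlib

open scoped TensorProduct

universe u v w

noncomputable section

namespace OrderedGP

/-! ### Polyhedra, faces and normal fans in `ℝ^I` -/

/-- The standard inner product on `ℝ^I`, for a finite set `I`. -/
def dot {I : Type u} (x y : I → ℝ) : ℝ := ∑ᶠ i, x i * y i

/-- An intersection of finitely many closed half-spaces. -/
def IsPolyhedron {I : Type u} (p : Set (I → ℝ)) : Prop :=
  ∃ (m : ℕ) (a : Fin m → I → ℝ) (b : Fin m → ℝ), p = {y | ∀ i, dot (a i) y ≤ b i}

/-- The face of `p` on which the linear functional `dot x` is maximal; it is empty if the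
functional is unbounded above on `p`. -/
def face {I : Type u} (p : Set (I → ℝ)) (x : I → ℝ) : Set (I → ℝ) :=
  {y | y ∈ p ∧ ∀ z ∈ p, dot x z ≤ dot x y}

/-- The (relatively open) normal cone of `q` in `p`. -/
def normalCone {I : Type u} (p q : Set (I → ℝ)) : Set (I → ℝ) := {x | face p x = q}

/-- The normal fan of `p`: the set of the normal cones of the nonempty faces of `p`. -/
def normalFan {I : Type u} (p : Set (I → ℝ)) : Set (Set (I → ℝ)) :=
  {N | ∃ x : I → ℝ, (face p x).Nonempty ∧ N = normalCone p (face p x)}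

/-! ### The braid fan and extended generalized permutahedra -/

/-- The relatively open face of the braid arrangement that contains `x`. -/
def braidFace {I : Type u} (x : I → ℝ) : Set (I → ℝ) :=
  {y | ∀ i j, y i < y j ↔ x i < x j}

/-- The braid fan: all relatively open faces of the braid arrangement in `ℝ^I`. -/
def braidFan (I : Type u) : Set (Set (I → ℝ)) := {σ | ∃ x : I → ℝ, σ = braidFace x}

/-- A convex subfan of the braid fan: a set of faces of the braid fan that is closed under passing
to faces and whose union is convex. -/
structure IsConvexBraidSubfan {I : Type u} (F : Set (Set (I → ℝ))) : Prop where
  subset : F ⊆ braidFan I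
  faces : ∀ σ ∈ F, ∀ τ ∈ braidFan I, τ ⊆ closure σ → τ ∈ F
  convex : Convex ℝ (⋃₀ F)

/-- The fan `N` coarsens the fan `F`: they have the same support, and every cone of `F` lies in
a cone of `N`. -/
def Coarsens {I : Type u} (N F : Set (Set (I → ℝ))) : Prop :=
  ⋃₀ N = ⋃₀ F ∧ ∀ σ ∈ F, ∃ τ ∈ N, σ ⊆ τ

/-- An extended generalized permutahedron: a nonempty polyhedron whose normal fan coarsens a
convex subfan of the braid fan. -/
def IsEGP {I : Type u} (p : Set (I → ℝ)) : Prop :=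
  IsPolyhedron p ∧ p.Nonempty ∧
    ∃ F : Set (Set (I → ℝ)), IsConvexBraidSubfan F ∧ Coarsens (normalFan p) F

/-! ### Auxiliary facts on polyhedra -/

lemma dot_comm {I : Type u} (x y : I → ℝ) : dot x y = dot y x := by
  simp only [dot, mul_comm]

lemma dot_add {I : Type u} [Finite I] (x y z : I → ℝ) : dot x (y + z) = dot x y + dot x z := by
  cases nonempty_fintype I
  simp [dot, finsum_eq_sum_of_fintype, mul_add, Finset.sum_add_distrib]

lemma dot_smul {I : Type u} [Finite I] (x : I → ℝ) (c : ℝ) (y : I → ℝ) :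
    dot x (c • y) = c * dot x y := by
  cases nonempty_fintype I
  simp [dot, finsum_eq_sum_of_fintype, Finset.mul_sum, mul_left_comm]

lemma add_dot {I : Type u} [Finite I] (x y z : I → ℝ) : dot (x + y) z = dot x z + dot y z := by
  rw [dot_comm, dot_add, dot_comm z, dot_comm z]

lemma smul_dot {I : Type u} [Finite I] (c : ℝ) (x y : I → ℝ) : dot (c • x) y = c * dot x y := by
  rw [dot_comm, dot_smul, dot_comm]

lemma zero_dot {I : Type u} (x : I → ℝ) : dot 0 x = 0 := by simp [dot]

lemma continuous_dot {I : Type u} [Finite I] (y : I → ℝ) : Continuous fun x : I → ℝ => dot x y := by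
  cases nonempty_fintype I
  simp only [dot, finsum_eq_sum_of_fintype]
  fun_prop

/-- The linear form `dot x`. -/
def dotLin {I : Type u} [Finite I] (x : I → ℝ) : (I → ℝ) →ₗ[ℝ] ℝ where
  toFun := dot x
  map_add' := dot_add x
  map_smul' c y := dot_smul x c y

/-- Farkas' lemma. -/
lemma farkas {W : Type*} [AddCommGroup W] [Module ℝ W] (m : ℕ) :
    ∀ (A : Fin m → W →ₗ[ℝ] ℝ) (B : W →ₗ[ℝ] ℝ),
      (∀ x, (∀ i, A i x ≤ 0) → B x ≤ 0) →
      ∃ l : Fin m → ℝ, (∀ i, 0 ≤ l i) ∧ ∀ x, B x = ∑ i, l i * A i x := by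
  induction m with
  | zero =>
    intro A B h
    refine ⟨0, by simp, fun x => ?_⟩
    have h1 := h x (fun i => i.elim0)
    have h2 := h (-x) (fun i => i.elim0)
    simp only [map_neg] at h2
    simp
    linarith
  | succ m ih =>
    intro A B h
    by_cases hc : ∀ x, (∀ i : Fin m, A i.succ x ≤ 0) → B x ≤ 0
    · obtain ⟨l, hl, hB⟩ := ih (fun i => A i.succ) B hc
      refine ⟨Fin.cons 0 l, fun i => ?_, fun x => ?_⟩
      · refine Fin.cases ?_ (fun j => ?_) i
        · simp
        · simpa using hl j
      · simp [Fin.sum_univ_succ, hB x]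
    · push Not at hc
      obtain ⟨x0, hx0, hB0⟩ := hc
      have hA0 : 0 < A 0 x0 := by
        by_contra hn
        push Not at hn
        exact absurd (h x0 (fun i => Fin.cases hn hx0 i)) (not_le.mpr hB0)
      set t := A 0 x0 with ht
      obtain ⟨l, hl, hB⟩ := ih (fun i => A i.succ - (A i.succ x0 / t) • A 0)
        (B - (B x0 / t) • A 0) (by
          intro x hx
          have hz := h (x - (A 0 x / t) • x0) (fun i => by
            refine Fin.cases ?_ (fun j => ?_) i
            · simp only [map_sub, map_smul, smul_eq_mul, ← ht]
              rw [div_mul_cancel₀ _ hA0.ne']; simp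
            · have := hx j
              simp only [map_sub, map_smul, smul_eq_mul, LinearMap.sub_apply,
                LinearMap.smul_apply] at this ⊢
              calc _ = A j.succ x - A j.succ x0 / t * A 0 x := by ring
                _ ≤ 0 := this)
          simp only [map_sub, map_smul, smul_eq_mul, LinearMap.sub_apply,
                LinearMap.smul_apply] at hz ⊢
          calc _ = B x - A 0 x / t * B x0 := by ring
            _ ≤ 0 := hz)
      refine ⟨Fin.cons (B x0 / t - ∑ i, l i * (A i.succ x0 / t)) l, fun i => ?_, fun x => ?_⟩
      · refine Fin.cases ?_ (fun j => ?_) i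
        · simp only [Fin.cons_zero]
          have : ∑ i, l i * (A i.succ x0 / t) ≤ 0 := Finset.sum_nonpos fun i _ =>
            mul_nonpos_of_nonneg_of_nonpos (hl i) (div_nonpos_of_nonpos_of_nonneg (hx0 i) hA0.le)
          have := div_pos hB0 hA0
          linarith
        · simpa using hl j
      · have := hB x
        simp only [LinearMap.sub_apply, LinearMap.smul_apply, smul_eq_mul, mul_sub,
          Finset.sum_sub_distrib] at this
        simp only [Fin.sum_univ_succ, Fin.cons_zero, Fin.cons_succ, sub_mul, Finset.sum_mul]
        simp only [← mul_assoc] at this ⊢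
        linarith

lemma farkas_infeasible {I : Type u} [Finite I] {m : ℕ} (a : Fin m → I → ℝ) (b : Fin m → ℝ)
    (h : ∀ y, ¬ ∀ i, dot (a i) y ≤ b i) :
    ∃ l : Fin m → ℝ, (∀ i, 0 ≤ l i) ∧ (∀ y, ∑ i, l i * dot (a i) y = 0) ∧
      ∑ i, l i * b i < 0 := by
  obtain ⟨l, hl, hB⟩ := farkas m
    (fun i => dotLin (a i) ∘ₗ LinearMap.fst ℝ (I → ℝ) ℝ - b i • LinearMap.snd ℝ (I → ℝ) ℝ)
    (LinearMap.snd ℝ (I → ℝ) ℝ) (by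
      rintro ⟨y, t⟩ hy
      by_contra ht
      simp only [LinearMap.snd_apply, not_le] at ht
      refine h (t⁻¹ • y) fun i => ?_
      have := hy i
      simp only [dotLin, LinearMap.sub_apply, LinearMap.comp_apply, LinearMap.fst_apply,
        LinearMap.smul_apply, LinearMap.snd_apply, smul_eq_mul, LinearMap.coe_mk,
        AddHom.coe_mk] at this
      rw [dot_smul, inv_mul_le_iff₀ ht]
      linarith)
  refine ⟨l, hl, fun y => ?_, ?_⟩
  · have := hB (y, 0)
    simpa [dotLin] using this.symm
  · have := hB (0, 1)
    have h0 : ∀ i, dot (a i) (0 : I → ℝ) = 0 := fun i => by rw [dot_comm, zero_dot]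
    simp [dotLin, h0] at this
    linarith

/-- Affine form of Farkas' lemma. -/
lemma farkas_affine {I : Type u} [Finite I] {m : ℕ} (a : Fin m → I → ℝ) (b : Fin m → ℝ)
    (hne : ∃ y, ∀ i, dot (a i) y ≤ b i) (c : I → ℝ) (M : ℝ)
    (h : ∀ y, (∀ i, dot (a i) y ≤ b i) → dot c y ≤ M) :
    ∃ l : Fin m → ℝ, (∀ i, 0 ≤ l i) ∧ (∀ y, dot c y = ∑ i, l i * dot (a i) y) ∧
      ∑ i, l i * b i ≤ M := by
  obtain ⟨y0, hy0⟩ := hne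
  obtain ⟨l, hl, hB⟩ := farkas (m + 1)
    (Fin.cons (-LinearMap.snd ℝ (I → ℝ) ℝ) (fun i =>
      dotLin (a i) ∘ₗ LinearMap.fst ℝ (I → ℝ) ℝ - b i • LinearMap.snd ℝ (I → ℝ) ℝ))
    (dotLin c ∘ₗ LinearMap.fst ℝ (I → ℝ) ℝ - M • LinearMap.snd ℝ (I → ℝ) ℝ) (by
      rintro ⟨y, t⟩ hy
      have ht : 0 ≤ t := by simpa using hy 0
      have hi : ∀ i, dot (a i) y ≤ b i * t := fun i => by
        simpa [dotLin] using hy i.succ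
      suffices dot c y ≤ M * t by simpa [dotLin] using this
      rcases ht.eq_or_lt with rfl | ht
      · simp only [mul_zero] at hi ⊢
        by_contra hn
        push Not at hn
        have := h (y0 + ((M - dot c y0 + 1) / dot c y) • y) (fun i => by
          rw [dot_add, dot_smul]
          have h1 : 0 ≤ (M - dot c y0 + 1) / dot c y := by
            have := h y0 hy0
            apply div_nonneg _ hn.le
            linarith
          nlinarith [hy0 i, hi i, mul_nonpos_of_nonneg_of_nonpos h1 (hi i)])
        rw [dot_add, dot_smul, div_mul_cancel₀ _ hn.ne'] at this
        linarith
      · have := h (t⁻¹ • y) (fun i => by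
          rw [dot_smul, inv_mul_le_iff₀ ht, mul_comm]; exact hi i)
        rw [dot_smul, inv_mul_le_iff₀ ht] at this
        linarith)
  refine ⟨fun i => l i.succ, fun i => hl _, fun y => ?_, ?_⟩
  · have := hB (y, 0)
    simpa [dotLin, Fin.sum_univ_succ] using this
  · have := hB (0, 1)
    have h0 : ∀ x : I → ℝ, dot x (0 : I → ℝ) = 0 := fun i => by rw [dot_comm, zero_dot]
    simp [dotLin, h0, Fin.sum_univ_succ] at this
    have := hl 0
    linarith

lemma IsPolyhedron.inter_halfspace {I : Type u} {p : Set (I → ℝ)} (hp : IsPolyhedron p)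
    (c : I → ℝ) (M : ℝ) : IsPolyhedron {y | y ∈ p ∧ dot c y ≤ M} := by
  obtain ⟨m, a, b, rfl⟩ := hp
  refine ⟨m + 1, Fin.cons c a, Fin.cons M b, ?_⟩
  ext y
  simp [Fin.forall_fin_succ, and_comm]

lemma IsPolyhedron.face {I : Type u} [Finite I] {p : Set (I → ℝ)} (hp : IsPolyhedron p)
    (x : I → ℝ) (h : (face p x).Nonempty) : IsPolyhedron (face p x) := by
  obtain ⟨y, hy, hmax⟩ := h
  convert hp.inter_halfspace ((-1 : ℝ) • x) (-dot x y) using 1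
  ext z
  simp only [OrderedGP.face, Set.mem_ofPred_eq, smul_dot]
  refine and_congr_right fun hz => ⟨fun h => ?_, fun h z' hz' => ?_⟩
  · linarith [h y hy]
  · linarith [hmax z' hz']

lemma face_nonempty_of_le {I : Type u} [Finite I] {p : Set (I → ℝ)} (hp : IsPolyhedron p)
    (hne : p.Nonempty) (c : I → ℝ) (M : ℝ) (h : ∀ y ∈ p, dot c y ≤ M) : (face p c).Nonempty := by
  obtain ⟨m, a, b, rfl⟩ := hp
  obtain ⟨y0, hy0⟩ := hne
  set p := {y | ∀ i, dot (a i) y ≤ b i} with hp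
  have hbdd : BddAbove (dot c '' p) := ⟨M, by rintro _ ⟨y, hy, rfl⟩; exact h y hy⟩
  have hle : ∀ y ∈ p, dot c y ≤ sSup (dot c '' p) := fun y hy => le_csSup hbdd ⟨y, hy, rfl⟩
  by_contra hemp
  obtain ⟨l, hl, hl0, hlb⟩ := farkas_infeasible (Fin.cons ((-1 : ℝ) • c) a)
    (Fin.cons (-sSup (dot c '' p)) b) (by
      intro y hy
      simp only [Fin.forall_fin_succ, Fin.cons_zero, Fin.cons_succ, smul_dot] at hy
      refine hemp ⟨y, hy.2, fun z hz => ?_⟩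
      linarith [hle z hz])
  simp only [Fin.sum_univ_succ, Fin.cons_zero, Fin.cons_succ, smul_dot] at hl0 hlb
  have key : ∀ y ∈ p, l 0 * dot c y ≤ ∑ i : Fin m, l i.succ * b i := fun y hy => by
    have h1 := hl0 y
    have h2 : ∑ i : Fin m, l i.succ * dot (a i) y ≤ ∑ i : Fin m, l i.succ * b i :=
      Finset.sum_le_sum fun i _ => mul_le_mul_of_nonneg_left (hy i) (hl _)
    linarith
  rcases (hl 0).eq_or_lt with h0 | h0
  · have := key y0 hy0
    rw [← h0] at this hlb
    linarith
  · have : sSup (dot c '' p) ≤ (∑ i : Fin m, l i.succ * b i) / l 0 :=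
      csSup_le ⟨_, y0, hy0, rfl⟩ (by
        rintro _ ⟨y, hy, rfl⟩
        rw [le_div_iff₀ h0, mul_comm]
        exact key y hy)
    rw [le_div_iff₀ h0] at this
    linarith

/-- The support of the normal fan of a nonempty polyhedron is the polar of its recession cone. -/
lemma exists_recession {I : Type u} [Finite I] {p : Set (I → ℝ)} (hp : IsPolyhedron p)
    (hne : p.Nonempty) :
    ∃ R : Set (I → ℝ), ∀ c, (face p c).Nonempty ↔ ∀ y ∈ R, dot c y ≤ 0 := by
  have hp' := hp
  obtain ⟨m, a, b, rfl⟩ := hp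
  refine ⟨{y | ∀ i, dot (a i) y ≤ 0}, fun c => ⟨?_, fun h => ?_⟩⟩
  · rintro ⟨y0, hy0, hmax⟩ y hy
    have := hmax (y0 + y) (fun i => by rw [dot_add]; linarith [hy0 i, hy i])
    rw [dot_add] at this
    linarith
  · obtain ⟨l, hl, hB⟩ := farkas m (fun i => dotLin (a i)) (dotLin c) h
    refine face_nonempty_of_le hp' hne c (∑ i, l i * b i) fun y hy => ?_
    have := hB y
    simp only [dotLin, LinearMap.coe_mk, AddHom.coe_mk] at this
    rw [this]
    exact Finset.sum_le_sum fun i _ => mul_le_mul_of_nonneg_left (hy i) (hl _)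

/-- Faces of a face `face p d` are faces of `p`. -/
lemma face_face {I : Type u} [Finite I] {p : Set (I → ℝ)} (hp : IsPolyhedron p) (d c : I → ℝ)
    (h : (face (face p d) c).Nonempty) :
    ∃ C0 : ℝ, ∀ C, C0 < C → face p (c + C • d) = face (face p d) c := by
  obtain ⟨m, a, b, rfl⟩ := hp
  set p := {y | ∀ i, dot (a i) y ≤ b i} with hp
  obtain ⟨z, ⟨hz, hzd⟩, hzc⟩ := h
  have heq : ∀ y, (∀ i, dot ((Fin.cons ((-1 : ℝ) • d) a : Fin (m + 1) → I → ℝ) i) y ≤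
      (Fin.cons (-dot d z) b : Fin (m + 1) → ℝ) i) → y ∈ face p d := by
    intro y hy
    simp only [Fin.forall_fin_succ, Fin.cons_zero, Fin.cons_succ, smul_dot] at hy
    exact ⟨hy.2, fun z' hz' => by linarith [hzd z' hz']⟩
  obtain ⟨l, hl, hlc, hlb⟩ := farkas_affine (Fin.cons ((-1 : ℝ) • d) a) (Fin.cons (-dot d z) b)
    ⟨z, by
      simp only [Fin.forall_fin_succ, Fin.cons_zero, Fin.cons_succ, smul_dot]
      exact ⟨by linarith, hz⟩⟩ c (dot c z) (fun y hy => hzc y (heq y hy))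
  simp only [Fin.sum_univ_succ, Fin.cons_zero, Fin.cons_succ, smul_dot] at hlc hlb
  have key : ∀ y ∈ p, dot c y + l 0 * dot d y ≤ dot c z + l 0 * dot d z := fun y hy => by
    have h1 := hlc y
    have h2 : ∑ i : Fin m, l i.succ * dot (a i) y ≤ ∑ i : Fin m, l i.succ * b i :=
      Finset.sum_le_sum fun i _ => mul_le_mul_of_nonneg_left (hy i) (hl _)
    linarith
  refine ⟨l 0, fun C hC => Set.ext fun y => ⟨fun hy => ?_, fun hy => ?_⟩⟩
  · obtain ⟨hyp, hy⟩ := hy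
    have h1 := hy z hz
    simp only [add_dot, smul_dot] at h1
    have h2 := key y hyp
    have h3 := hzd y hyp
    have h4 : dot d z ≤ dot d y := by
      by_contra hn
      push Not at hn
      nlinarith
    have h5 : dot d y = dot d z := le_antisymm h3 h4
    rw [h5] at h1 h2
    refine ⟨⟨hyp, fun z' hz' => ?_⟩, fun z' hz' => ?_⟩
    · rw [h5]; exact hzd z' hz'
    · have := hzc z' hz'
      linarith
  · obtain ⟨⟨hyp, hyd⟩, hyc⟩ := hy
    have h1 : dot d y = dot d z := le_antisymm (hzd y hyp) (hyd z hz)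
    have h2 := hyc z ⟨hz, hzd⟩
    refine ⟨hyp, fun z' hz' => ?_⟩
    simp only [add_dot, smul_dot]
    have h3 := key z' hz'
    have h4 := hzd z' hz'
    rw [h1]
    nlinarith

/-- If a face of `p` in direction `c + C • d` lies in `face p d`, it is a face of the latter. -/
lemma face_eq_of_subset {I : Type u} [Finite I] {p : Set (I → ℝ)} (d c : I → ℝ) (C : ℝ)
    (hne : (face p (c + C • d)).Nonempty) (h : face p (c + C • d) ⊆ face p d) :
    face (face p d) c = face p (c + C • d) := by
  obtain ⟨z, hz⟩ := hne
  have hzd := h hz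
  ext y
  constructor
  · rintro ⟨⟨hyp, hyd⟩, hyc⟩
    refine ⟨hyp, fun z' hz' => (hz.2 z' hz').trans ?_⟩
    have h1 : dot d y = dot d z := le_antisymm (hzd.2 y hyp) (hyd z hzd.1)
    have h2 := hyc z hzd
    simp only [add_dot, smul_dot, h1]
    linarith
  · intro hy
    have hyd := h hy
    refine ⟨hyd, fun z' hz' => ?_⟩
    have h1 : dot d z' = dot d y := le_antisymm (hyd.2 z' hz'.1) (hz'.2 y hyd.1)
    have h2 := hy.2 z' hz'.1
    simp only [add_dot, smul_dot, h1] at h2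
    linarith

/-! ### Auxiliary facts on extended generalized permutahedra -/

lemma mem_sUnion_normalFan {I : Type u} {p : Set (I → ℝ)} {x : I → ℝ} :
    x ∈ ⋃₀ normalFan p ↔ (face p x).Nonempty := by
  constructor
  · rintro ⟨N, ⟨y, hy, rfl⟩, hx⟩
    have : face p x = face p y := hx
    rwa [this]
  · intro h
    exact ⟨_, ⟨x, h, rfl⟩, rfl⟩

lemma mem_braidFace_self {I : Type u} (x : I → ℝ) : x ∈ braidFace x := fun _ _ => Iff.rfl

lemma IsEGP.face_eq {I : Type u} {p : Set (I → ℝ)} (hp : IsEGP p) {x y : I → ℝ}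
    (hxy : y ∈ braidFace x) (hx : (face p x).Nonempty) : face p y = face p x := by
  obtain ⟨-, -, F, hF, hs, hc⟩ := hp
  have h1 : x ∈ ⋃₀ F := hs ▸ mem_sUnion_normalFan.2 hx
  obtain ⟨σ, hσ, hxσ⟩ := h1
  obtain ⟨z, rfl⟩ := hF.subset hσ
  obtain ⟨N, ⟨t, -, rfl⟩, hsub⟩ := hc _ hσ
  have hy : y ∈ braidFace z := fun i j => (hxy i j).trans (hxσ i j)
  exact Eq.trans (hsub hy) (Eq.symm (hsub hxσ))

lemma isEGP_of_face_eq {I : Type u} [Finite I] {p : Set (I → ℝ)} (hp : IsPolyhedron p)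
    (hne : p.Nonempty)
    (h : ∀ x y, y ∈ braidFace x → (face p x).Nonempty → face p y = face p x) : IsEGP p := by
  obtain ⟨R, hR⟩ := exists_recession hp hne
  have hU : ⋃₀ {σ | ∃ x, (face p x).Nonempty ∧ σ = braidFace x} = {x | (face p x).Nonempty} := by
    ext x
    constructor
    · rintro ⟨σ, ⟨z, hz, rfl⟩, hx⟩
      change (face p x).Nonempty
      rwa [h z x hx hz]
    · exact fun hx => ⟨_, ⟨x, hx, rfl⟩, mem_braidFace_self x⟩
  refine ⟨hp, hne, {σ | ∃ x, (face p x).Nonempty ∧ σ = braidFace x}, ⟨?_, ?_, ?_⟩, ?_, ?_⟩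
  · rintro _ ⟨x, -, rfl⟩
    exact ⟨x, rfl⟩
  · rintro _ ⟨x, hx, rfl⟩ _ ⟨z, rfl⟩ hτ
    refine ⟨z, (hR z).2 fun y hy => ?_, rfl⟩
    have hz := hτ (mem_braidFace_self z)
    have hcl : IsClosed {c : I → ℝ | dot c y ≤ 0} := isClosed_le (continuous_dot y) continuous_const
    refine hcl.closure_subset_iff.2 (fun c hc => ?_) hz
    exact (hR c).1 (by rwa [h x c hc hx]) y hy
  · rw [hU]
    intro x hx y hy s t hs ht _
    refine (hR _).2 fun z hz => ?_
    rw [add_dot, smul_dot, smul_dot]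
    have h1 := (hR _).1 hx z hz
    have h2 := (hR _).1 hy z hz
    nlinarith
  · rw [hU]
    ext x
    exact mem_sUnion_normalFan
  · rintro _ ⟨x, hx, rfl⟩
    exact ⟨_, ⟨x, hx, rfl⟩, fun y hy => h x y hy hx⟩
lemma dot_sum {I J : Type u} [Finite I] [Finite J] (x y : I ⊕ J → ℝ) :
    dot x y = dot (x ∘ Sum.inl) (y ∘ Sum.inl) + dot (x ∘ Sum.inr) (y ∘ Sum.inr) := by
  cases nonempty_fintype I
  cases nonempty_fintype J
  simp [dot, finsum_eq_sum_of_fintype]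

lemma dot_comp_equiv {I J : Type u} (e : I ≃ J) (x y : J → ℝ) :
    dot (x ∘ e) (y ∘ e) = dot x y :=
  finsum_comp_equiv e (f := fun j => x j * y j)

/-- The transport of a subset of `ℝ^I` along a bijection `I ≃ J`. -/
def relabelSet {I J : Type u} (e : I ≃ J) (p : Set (I → ℝ)) : Set (J → ℝ) := {y | y ∘ e ∈ p}

/-- The Cartesian product of `p ⊆ ℝ^I` and `q ⊆ ℝ^J`, as a subset of `ℝ^(I ⊔ J)`. -/
def prodSet {I J : Type u} (p : Set (I → ℝ)) (q : Set (J → ℝ)) : Set (I ⊕ J → ℝ) :=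
  {y | y ∘ Sum.inl ∈ p ∧ y ∘ Sum.inr ∈ q}

/-- The indicator vector of `I` in `ℝ^(I ⊔ J)`. -/
def indicatorLeft (I J : Type u) : I ⊕ J → ℝ := Sum.elim 1 0

/-- `p|I`: the projection to `ℝ^I` of the face of `p` that maximizes the sum of the coordinates
in `I`. -/
def restrSet {I J : Type u} (p : Set (I ⊕ J → ℝ)) : Set (I → ℝ) :=
  (fun y => y ∘ Sum.inl) '' face p (indicatorLeft I J)

/-- `p/I`: the projection to `ℝ^J` of the face of `p` that maximizes the sum of the coordinates
in `I`. -/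
def contrSet {I J : Type u} (p : Set (I ⊕ J → ℝ)) : Set (J → ℝ) :=
  (fun y => y ∘ Sum.inr) '' face p (indicatorLeft I J)

lemma face_relabelSet {I J : Type u} (e : I ≃ J) (p : Set (I → ℝ)) (x : J → ℝ) :
    face (relabelSet e p) x = relabelSet e (face p (x ∘ e)) := by
  ext y
  simp only [face, relabelSet, Set.mem_ofPred_eq, dot_comp_equiv]
  refine and_congr_right fun _ => ⟨fun h z hz => ?_, fun h z hz => ?_⟩
  · have h1 := h (z ∘ e.symm) (by simpa [Function.comp_assoc] using hz)
    rw [← dot_comp_equiv e] at h1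
    simpa [Function.comp_assoc, dot_comp_equiv] using h1
  · have h1 := h (z ∘ e) hz
    rwa [dot_comp_equiv] at h1

lemma IsEGP.relabel {I J : Type u} [Finite I] [Finite J] {p : Set (I → ℝ)} (hp : IsEGP p)
    (e : I ≃ J) : IsEGP (relabelSet e p) := by
  refine isEGP_of_face_eq ?_ ?_ ?_
  · obtain ⟨m, a, b, rfl⟩ := hp.1
    refine ⟨m, fun i => a i ∘ e.symm, b, ?_⟩
    ext y
    refine forall_congr' fun i => ?_
    rw [← dot_comp_equiv e.symm]
    simp [Function.comp_assoc]
  · obtain ⟨y, hy⟩ := hp.2.1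
    exact ⟨y ∘ e.symm, by simpa [relabelSet, Function.comp_assoc] using hy⟩
  · intro x y hxy hx
    rw [face_relabelSet] at hx
    rw [face_relabelSet, face_relabelSet]
    obtain ⟨z, hz⟩ := hx
    rw [hp.face_eq (x := x ∘ e) (y := y ∘ e) (fun i j => hxy _ _) ⟨_, hz⟩]

lemma face_prodSet {I J : Type u} [Finite I] [Finite J] (p : Set (I → ℝ)) (q : Set (J → ℝ))
    (x : I ⊕ J → ℝ) :
    face (prodSet p q) x = prodSet (face p (x ∘ Sum.inl)) (face q (x ∘ Sum.inr)) := by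
  ext y
  constructor
  · rintro ⟨⟨hp, hq⟩, h⟩
    refine ⟨⟨hp, fun z hz => ?_⟩, ⟨hq, fun z hz => ?_⟩⟩
    · have := h (Sum.elim z (y ∘ Sum.inr)) ⟨hz, hq⟩
      simp only [dot_sum, Sum.elim_comp_inl, Sum.elim_comp_inr] at this
      linarith
    · have := h (Sum.elim (y ∘ Sum.inl) z) ⟨hp, hz⟩
      simp only [dot_sum, Sum.elim_comp_inl, Sum.elim_comp_inr] at this
      linarith
  · rintro ⟨⟨hp, h1⟩, ⟨hq, h2⟩⟩
    refine ⟨⟨hp, hq⟩, fun z hz => ?_⟩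
    simp only [dot_sum]
    linarith [h1 _ hz.1, h2 _ hz.2]

lemma IsEGP.prod {I J : Type u} [Finite I] [Finite J] {p : Set (I → ℝ)} {q : Set (J → ℝ)}
    (hp : IsEGP p) (hq : IsEGP q) : IsEGP (prodSet p q) := by
  refine isEGP_of_face_eq ?_ ?_ ?_
  · obtain ⟨m, a, b, rfl⟩ := hp.1
    obtain ⟨n, c, d, rfl⟩ := hq.1
    refine ⟨m + n, Fin.append (fun i => Sum.elim (a i) 0) (fun i => Sum.elim 0 (c i)),
      Fin.append b d, ?_⟩
    ext y
    simp only [prodSet, Set.mem_ofPred_eq]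
    constructor
    · rintro ⟨h1, h2⟩ i
      refine Fin.addCases (fun i => ?_) (fun i => ?_) i
      · simpa [dot_sum, zero_dot] using h1 i
      · simpa [dot_sum, zero_dot] using h2 i
    · intro h
      exact ⟨fun i => by simpa [dot_sum, zero_dot] using h (Fin.castAdd n i),
        fun i => by simpa [dot_sum, zero_dot] using h (Fin.natAdd m i)⟩
  · obtain ⟨y, hy⟩ := hp.2.1
    obtain ⟨z, hz⟩ := hq.2.1
    exact ⟨Sum.elim y z, hy, hz⟩
  · intro x y hxy hx
    rw [face_prodSet] at hx
    rw [face_prodSet, face_prodSet]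
    obtain ⟨z, hz⟩ := hx
    rw [hp.face_eq (x := x ∘ Sum.inl) (y := y ∘ Sum.inl) (fun i j => hxy _ _) ⟨_, hz.1⟩,
      hq.face_eq (x := x ∘ Sum.inr) (y := y ∘ Sum.inr) (fun i j => hxy _ _) ⟨_, hz.2⟩]

/-- After adding a large multiple of the indicator vector of `I`, the braid face of a vector is
determined by the braid faces of its two parts. -/
lemma exists_braidFace_add {I J : Type u} [Finite I] [Finite J] {x x' : I → ℝ} {y y' : J → ℝ}
    (hx : x' ∈ braidFace x) (hy : y' ∈ braidFace y) :
    ∃ C1 : ℝ, ∀ C, C1 < C → Sum.elim x' y' + C • indicatorLeft I J ∈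
      braidFace (Sum.elim x y + C • indicatorLeft I J) := by
  obtain ⟨c, hc⟩ := (Set.finite_range fun t : I × J => y t.2 - x t.1).bddAbove
  obtain ⟨c', hc'⟩ := (Set.finite_range fun t : I × J => y' t.2 - x' t.1).bddAbove
  refine ⟨max c c', fun C hC => ?_⟩
  have h1 : ∀ i j, y j < x i + C := fun i j => by
    have := hc ⟨(i, j), rfl⟩
    have := (le_max_left c c').trans_lt hC
    simp only at *
    linarith
  have h2 : ∀ i j, y' j < x' i + C := fun i j => by
    have := hc' ⟨(i, j), rfl⟩
    have := (le_max_right c c').trans_lt hC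
    simp only at *
    linarith
  rintro (i | i) (j | j)
  · simpa [indicatorLeft] using hx i j
  · simp [indicatorLeft, (h1 i j).not_gt, (h2 i j).not_gt]
  · simp [indicatorLeft, h1 j i, h2 j i]
  · simpa [indicatorLeft] using hy i j

/-- The dependence on a direction of the faces of `face p (indicatorLeft I J)`. -/
lemma IsEGP.face_face_eq {I J : Type u} [Finite I] [Finite J] {p : Set (I ⊕ J → ℝ)}
    (hp : IsEGP p) {x x' : I → ℝ} {y y' : J → ℝ} (hx : x' ∈ braidFace x) (hy : y' ∈ braidFace y)
    (h : (face (face p (indicatorLeft I J)) (Sum.elim x y)).Nonempty) :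
    face (face p (indicatorLeft I J)) (Sum.elim x' y') =
      face (face p (indicatorLeft I J)) (Sum.elim x y) := by
  obtain ⟨C0, hC0⟩ := face_face hp.1 _ _ h
  obtain ⟨C1, hC1⟩ := exists_braidFace_add hx hy
  have h0 := hC0 (max C0 C1 + 1) (by linarith [le_max_left C0 C1])
  have h1 := hp.face_eq (hC1 (max C0 C1 + 1) (by linarith [le_max_right C0 C1])) (by rwa [h0])
  rw [h0] at h1
  rw [← h1]
  refine face_eq_of_subset _ _ _ (by rwa [h1]) ?_
  rw [h1]
  exact fun z hz => hz.1

lemma IsEGP.glue {I J : Type u} [Finite I] [Finite J] {p : Set (I ⊕ J → ℝ)} (hp : IsEGP p)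
    {y z : I ⊕ J → ℝ} (hy : y ∈ face p (indicatorLeft I J))
    (hz : z ∈ face p (indicatorLeft I J)) :
    Sum.elim (y ∘ Sum.inl) (z ∘ Sum.inr) ∈ face p (indicatorLeft I J) := by
  have hq := hp.1.face (indicatorLeft I J) ⟨y, hy⟩
  have hq' := hq
  obtain ⟨m, a, b, hab⟩ := hq'
  rw [hab]
  intro i
  have hle : ∀ t ∈ face p (indicatorLeft I J), dot (a i) t ≤ b i := fun t ht => by
    rw [hab] at ht
    exact ht i
  set u := a i ∘ Sum.inl with hu
  set v := a i ∘ Sum.inr with hv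
  have hai : a i = Sum.elim u v := by rw [hu, hv, Sum.elim_comp_inl_inr]
  have hne := face_nonempty_of_le hq ⟨y, hy⟩ (a i) (b i) hle
  obtain ⟨t, ht⟩ := hne
  have hs : ∀ s : ℝ, 0 < s → ∀ z' ∈ face p (indicatorLeft I J),
      s * dot u (z' ∘ Sum.inl) + dot v (z' ∘ Sum.inr) ≤
        s * dot u (t ∘ Sum.inl) + dot v (t ∘ Sum.inr) := by
    intro s hs z' hz'
    have h1 : s • u ∈ braidFace u := fun i j => by
      simp [mul_lt_mul_iff_right₀ hs]
    have h2 := hp.face_face_eq h1 (mem_braidFace_self v) (by rw [← hai]; exact ⟨t, ht⟩)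
    rw [← hai] at h2
    rw [← h2] at ht
    have h3 := ht.2 z' hz'
    simpa only [dot_sum, Sum.elim_comp_inl, Sum.elim_comp_inr, smul_dot] using h3
  have hA : dot u (y ∘ Sum.inl) ≤ dot u (t ∘ Sum.inl) := by
    by_contra hn
    push Not at hn
    set A := dot u (y ∘ Sum.inl) - dot u (t ∘ Sum.inl) with hA
    set B := dot v (y ∘ Sum.inr) - dot v (t ∘ Sum.inr) with hB
    have hA0 : 0 < A := sub_pos.2 hn
    have h1 := hs ((|B| + 1) / A) (by positivity) y hy
    have h2 : (|B| + 1) / A * A = |B| + 1 := div_mul_cancel₀ _ hA0.ne'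
    rw [hA, mul_sub] at h2
    have h3 := neg_abs_le B
    linarith
  have hB : dot v (z ∘ Sum.inr) ≤ dot v (t ∘ Sum.inr) := by
    by_contra hn
    push Not at hn
    set A := dot u (z ∘ Sum.inl) - dot u (t ∘ Sum.inl) with hA
    set B := dot v (z ∘ Sum.inr) - dot v (t ∘ Sum.inr) with hB
    have hB0 : 0 < B := sub_pos.2 hn
    have h1 := hs (B / (|A| + 1)) (by positivity) z hz
    have h2 : B / (|A| + 1) * (|A| + 1) = B := div_mul_cancel₀ _ (by positivity)
    have h4 : 0 < B / (|A| + 1) := by positivity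
    have h5 : B / (|A| + 1) * (-|A|) ≤ B / (|A| + 1) * A :=
      mul_le_mul_of_nonneg_left (neg_abs_le A) h4.le
    have h6 : B / (|A| + 1) * A = B / (|A| + 1) * dot u (z ∘ Sum.inl) -
      B / (|A| + 1) * dot u (t ∘ Sum.inl) := by rw [hA, mul_sub]
    linarith
  have h1 := hle t ht.1
  rw [hai, dot_sum] at h1 ⊢
  simp only [Sum.elim_comp_inl, Sum.elim_comp_inr] at h1 ⊢
  linarith

/-- The face of `p` in the direction of the indicator vector of `I` is `p|I × p/I`. -/
lemma IsEGP.face_eq_prodSet {I J : Type u} [Finite I] [Finite J] {p : Set (I ⊕ J → ℝ)}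
    (hp : IsEGP p) : face p (indicatorLeft I J) = prodSet (restrSet p) (contrSet p) := by
  ext y
  constructor
  · exact fun hy => ⟨⟨y, hy, rfl⟩, ⟨y, hy, rfl⟩⟩
  · rintro ⟨⟨y1, h1, e1⟩, ⟨y2, h2, e2⟩⟩
    have := hp.glue h1 h2
    simp only at e1 e2
    rwa [e1, e2, Sum.elim_comp_inl_inr] at this

lemma IsEGP.restr {I J : Type u} [Finite I] [Finite J] {p : Set (I ⊕ J → ℝ)} (hp : IsEGP p)
    (h : (face p (indicatorLeft I J)).Nonempty) : IsEGP (restrSet p) := by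
  obtain ⟨z, hz⟩ := h
  have hzc : z ∘ Sum.inr ∈ contrSet p := ⟨z, hz, rfl⟩
  have heq := hp.face_eq_prodSet
  refine isEGP_of_face_eq ?_ ⟨_, z, hz, rfl⟩ ?_
  · obtain ⟨m, a, b, hab⟩ := hp.1.face _ ⟨z, hz⟩
    refine ⟨m, fun i => a i ∘ Sum.inl, fun i => b i - dot (a i ∘ Sum.inr) (z ∘ Sum.inr), ?_⟩
    ext x
    have h1 : x ∈ restrSet p ↔ Sum.elim x (z ∘ Sum.inr) ∈ face p (indicatorLeft I J) := by
      rw [heq]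
      simp [prodSet, hzc]
    rw [h1, hab]
    refine forall_congr' fun i => ?_
    rw [dot_sum]
    simp [le_sub_iff_add_le]
  · intro x x' hx hne
    have hf : ∀ x, face (face p (indicatorLeft I J)) (Sum.elim x 0) =
        prodSet (face (restrSet p) x) (contrSet p) := fun x => by
      rw [heq, face_prodSet]
      simp [face, zero_dot]
    have h0 := hp.face_face_eq hx (mem_braidFace_self (0 : J → ℝ)) (by
      obtain ⟨t, ht⟩ := hne
      rw [hf]
      exact ⟨Sum.elim t (z ∘ Sum.inr), by simpa [prodSet] using ⟨ht, hzc⟩⟩)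
    rw [hf, hf] at h0
    ext t
    have := congrArg (Sum.elim t (z ∘ Sum.inr) ∈ ·) h0
    simpa [prodSet, hzc] using this

lemma IsEGP.contr {I J : Type u} [Finite I] [Finite J] {p : Set (I ⊕ J → ℝ)} (hp : IsEGP p)
    (h : (face p (indicatorLeft I J)).Nonempty) : IsEGP (contrSet p) := by
  obtain ⟨z, hz⟩ := h
  have hzc : z ∘ Sum.inl ∈ restrSet p := ⟨z, hz, rfl⟩
  have heq := hp.face_eq_prodSet
  refine isEGP_of_face_eq ?_ ⟨_, z, hz, rfl⟩ ?_
  · obtain ⟨m, a, b, hab⟩ := hp.1.face _ ⟨z, hz⟩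
    refine ⟨m, fun i => a i ∘ Sum.inr, fun i => b i - dot (a i ∘ Sum.inl) (z ∘ Sum.inl), ?_⟩
    ext x
    have h1 : x ∈ contrSet p ↔ Sum.elim (z ∘ Sum.inl) x ∈ face p (indicatorLeft I J) := by
      rw [heq]
      simp [prodSet, hzc]
    rw [h1, hab]
    refine forall_congr' fun i => ?_
    rw [dot_sum]
    simp [le_sub_iff_add_le, add_comm]
  · intro x x' hx hne
    have hf : ∀ x, face (face p (indicatorLeft I J)) (Sum.elim 0 x) =
        prodSet (restrSet p) (face (contrSet p) x) := fun x => by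
      rw [heq, face_prodSet]
      simp [face, zero_dot]
    have h0 := hp.face_face_eq (mem_braidFace_self (0 : I → ℝ)) hx (by
      obtain ⟨t, ht⟩ := hne
      rw [hf]
      exact ⟨Sum.elim (z ∘ Sum.inl) t, by simpa [prodSet] using ⟨hzc, ht⟩⟩)
    rw [hf, hf] at h0
    ext t
    have := congrArg (Sum.elim (z ∘ Sum.inl) t ∈ ·) h0
    simpa [prodSet, hzc] using this

lemma isEGP_univ_of_isEmpty {I : Type u} [IsEmpty I] : IsEGP (Set.univ : Set (I → ℝ)) :=
  isEGP_of_face_eq ⟨0, fun i => i.elim0, fun i => i.elim0, by simp⟩ Set.univ_nonempty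
    fun x y _ _ => by rw [Subsingleton.elim x y]

/-! ### Extended generalized permutahedra and their operations -/

/-- The set of extended generalized permutahedra in `ℝ^I`. -/
def EGP (I : Type u) : Type u := {p : Set (I → ℝ) // IsEGP p}

/-- Relabelling of an extended generalized permutahedron along a bijection. -/
def EGP.relabel {I J : Type u} [Finite I] [Finite J] (e : I ≃ J) (p : EGP I) : EGP J :=
  ⟨relabelSet e p.1, p.2.relabel e⟩

/-- The Cartesian product `p × q`. -/
def EGP.prod {I J : Type u} [Finite I] [Finite J] (p : EGP I) (q : EGP J) : EGP (I ⊕ J) :=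
  ⟨prodSet p.1 q.1, p.2.prod q.2⟩

/-- `p` is bounded above in the direction of the indicator vector of `I`, that is, the
corresponding maximizing face is not empty. -/
def EGP.BoundedLeft {I J : Type u} (p : EGP (I ⊕ J)) : Prop :=
  (face p.1 (indicatorLeft I J)).Nonempty

/-- The restriction `p|I`. -/
def EGP.restr {I J : Type u} [Finite I] [Finite J] (p : EGP (I ⊕ J)) (h : p.BoundedLeft) :
    EGP I := ⟨restrSet p.1, p.2.restr h⟩

/-- The contraction `p/I`. -/
def EGP.contr {I J : Type u} [Finite I] [Finite J] (p : EGP (I ⊕ J)) (h : p.BoundedLeft) :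
    EGP J := ⟨contrSet p.1, p.2.contr h⟩

/-- The only extended generalized permutahedron in `ℝ^∅`: a point. -/
def EGP.point : EGP PEmpty.{u + 1} := ⟨Set.univ, isEGP_univ_of_isEmpty⟩

/-! ### Linear orders -/

/-- The set of linear orders on `I`; `w.1 i j` means that `i` comes before `j` in `w` or `i = j`. -/
def LinearOrd (I : Type u) : Type u := {r : I → I → Prop // IsLinearOrder I r}

/-- The linear order induced on `J` by a linear order on `I` and an injection `J → I`. -/
def LinearOrd.comap {I J : Type u} (f : J → I) (hf : Function.Injective f) (w : LinearOrd I) :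
    LinearOrd J :=
  ⟨Function.onFun w.1 f, @Function.Injective.isLinearOrder_onFun _ _ w.1 f hf w.2⟩

/-- Relabelling of a linear order along a bijection. -/
def LinearOrd.relabel {I J : Type u} (e : I ≃ J) (w : LinearOrd I) : LinearOrd J :=
  w.comap e.symm e.symm.injective

/-- The restriction of a linear order on `I ⊔ J` to `I`. -/
def LinearOrd.left {I J : Type u} (v : LinearOrd (I ⊕ J)) : LinearOrd I := v.comap Sum.inl Sum.inl_injective

/-- The restriction of a linear order on `I ⊔ J` to `J`. -/
def LinearOrd.right {I J : Type u} (v : LinearOrd (I ⊕ J)) : LinearOrd J :=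
  v.comap Sum.inr Sum.inr_injective

/-- The restriction of `v` to `I` is an initial segment of `v`. -/
def LinearOrd.LeftInitial {I J : Type u} (v : LinearOrd (I ⊕ J)) : Prop :=
  ∀ (i : I) (j : J), v.1 (Sum.inl i) (Sum.inr j)

/-- The shuffles of `w` and `t`. -/
def shuffles {I J : Type u} (w : LinearOrd I) (t : LinearOrd J) : Set (LinearOrd (I ⊕ J)) :=
  {v | v.left = w ∧ v.right = t}

instance {I : Type u} [Finite I] : Finite (LinearOrd I) := by
  unfold LinearOrd
  infer_instance

/-- The linear order on the empty set. -/
def LinearOrd.empty : LinearOrd PEmpty.{u + 1} :=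
  ⟨fun _ _ => True, { refl := fun i => i.elim, trans := fun i => i.elim,
                      antisymm := fun i => i.elim, total := fun i => i.elim }⟩

/-! ### Hopf monoids in vector species -/

/-- The data of a Hopf monoid in vector species over `k`: the vector spaces `H[I]` for all finite
sets `I`, their relabelling maps, products, coproducts, unit and counit. The unit
species is concentrated on the empty set, where it is `k`, so that the unit is given by an element
of `H[∅]` and the counit by a linear form on `H[∅]`. -/
structure HopfMonoidData (k : Type v) [Field k] where
  obj : (I : Type u) → [Finite I] → Type w
  [addCommGroup : ∀ (I : Type u) [Finite I], AddCommGroup (obj I)]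
  [module : ∀ (I : Type u) [Finite I], Module k (obj I)]
  map : ∀ {I J : Type u} [Finite I] [Finite J], I ≃ J → (obj I →ₗ[k] obj J)
  mul : ∀ (I J : Type u) [Finite I] [Finite J], obj I ⊗[k] obj J →ₗ[k] obj (I ⊕ J)
  comul : ∀ (I J : Type u) [Finite I] [Finite J], obj (I ⊕ J) →ₗ[k] obj I ⊗[k] obj J
  one : obj PEmpty.{u + 1}
  counit : obj PEmpty.{u + 1} →ₗ[k] k

attribute [instance] HopfMonoidData.addCommGroup HopfMonoidData.module

/-- The axioms of a connected Hopf monoid in vector species: functoriality, naturality,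
(co)associativity, (co)unitality, the compatibility of products and coproducts, and `H[∅] = k`.
(In the connected case the antipode exists and is given by Takeuchi's formula in terms of the
products and coproducts.) -/
structure IsHopfMonoid {k : Type v} [Field k] (H : HopfMonoidData.{u, v, w} k) : Prop where
  map_refl : ∀ (I : Type u) [Finite I], H.map (Equiv.refl I) = LinearMap.id
  map_trans : ∀ {I J K : Type u} [Finite I] [Finite J] [Finite K] (e : I ≃ J) (f : J ≃ K),
    H.map (e.trans f) = H.map f ∘ₗ H.map e
  mul_natural : ∀ {I J I' J' : Type u} [Finite I] [Finite J] [Finite I'] [Finite J']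
    (e : I ≃ I') (f : J ≃ J'),
    H.map (Equiv.sumCongr e f) ∘ₗ H.mul I J =
      H.mul I' J' ∘ₗ TensorProduct.map (H.map e) (H.map f)
  comul_natural : ∀ {I J I' J' : Type u} [Finite I] [Finite J] [Finite I'] [Finite J']
    (e : I ≃ I') (f : J ≃ J'),
    H.comul I' J' ∘ₗ H.map (Equiv.sumCongr e f) =
      TensorProduct.map (H.map e) (H.map f) ∘ₗ H.comul I J
  mul_assoc : ∀ (I J K : Type u) [Finite I] [Finite J] [Finite K],
    H.map (Equiv.sumAssoc I J K) ∘ₗ H.mul (I ⊕ J) K ∘ₗ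
        TensorProduct.map (H.mul I J) LinearMap.id =
      H.mul I (J ⊕ K) ∘ₗ TensorProduct.map LinearMap.id (H.mul J K) ∘ₗ
        (TensorProduct.assoc k (H.obj I) (H.obj J) (H.obj K)).toLinearMap
  comul_assoc : ∀ (I J K : Type u) [Finite I] [Finite J] [Finite K],
    TensorProduct.map LinearMap.id (H.comul J K) ∘ₗ H.comul I (J ⊕ K) ∘ₗ
        H.map (Equiv.sumAssoc I J K) =
      (TensorProduct.assoc k (H.obj I) (H.obj J) (H.obj K)).toLinearMap ∘ₗ
        TensorProduct.map (H.comul I J) LinearMap.id ∘ₗ H.comul (I ⊕ J) K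
  one_mul : ∀ (I : Type u) [Finite I] (x : H.obj I),
    H.map (Equiv.emptySum PEmpty I) (H.mul PEmpty I (H.one ⊗ₜ[k] x)) = x
  mul_one : ∀ (I : Type u) [Finite I] (x : H.obj I),
    H.map (Equiv.sumEmpty I PEmpty) (H.mul I PEmpty (x ⊗ₜ[k] H.one)) = x
  counit_comul : ∀ (I : Type u) [Finite I] (x : H.obj I),
    TensorProduct.lid k (H.obj I) (TensorProduct.map H.counit LinearMap.id
      (H.comul PEmpty I (H.map (Equiv.emptySum PEmpty I).symm x))) = x
  comul_counit : ∀ (I : Type u) [Finite I] (x : H.obj I),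
    TensorProduct.rid k (H.obj I) (TensorProduct.map LinearMap.id H.counit
      (H.comul I PEmpty (H.map (Equiv.sumEmpty I PEmpty).symm x))) = x
  comul_mul : ∀ (A B C D : Type u) [Finite A] [Finite B] [Finite C] [Finite D],
    H.comul (A ⊕ C) (B ⊕ D) ∘ₗ H.map (Equiv.sumSumSumComm A B C D) ∘ₗ
        H.mul (A ⊕ B) (C ⊕ D) =
      TensorProduct.map (H.mul A C) (H.mul B D) ∘ₗ
        (TensorProduct.tensorTensorTensorComm k (H.obj A) (H.obj B)
          (H.obj C) (H.obj D)).toLinearMap ∘ₗ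
        TensorProduct.map (H.comul A B) (H.comul C D)
  comul_one : H.comul PEmpty PEmpty (H.map (Equiv.sumEmpty PEmpty PEmpty).symm H.one) =
    H.one ⊗ₜ[k] H.one
  counit_mul : ∀ x y : H.obj PEmpty,
    H.counit (H.map (Equiv.sumEmpty PEmpty PEmpty) (H.mul PEmpty PEmpty (x ⊗ₜ[k] y))) =
      H.counit x * H.counit y
  counit_one : H.counit H.one = 1
  connected : ∀ x : H.obj PEmpty, H.counit x • H.one = x

/-- A family of subspaces `W[I] ⊆ H[I]` is a Hopf submonoid if it is a subspecies that contains the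
unit, with `W[I] · W[J] ⊆ W[I ⊔ J]` and `Δ_{I,J}(W[I ⊔ J]) ⊆ W[I] ⊗ W[J]`. -/
structure IsHopfSubmonoid {k : Type v} [Field k] (H : HopfMonoidData.{u, v, w} k)
    (W : (I : Type u) → [Finite I] → Submodule k (H.obj I)) : Prop where
  map_mem : ∀ {I J : Type u} [Finite I] [Finite J] (e : I ≃ J), ∀ x ∈ W I, H.map e x ∈ W J
  one_mem : H.one ∈ W PEmpty
  mul_mem : ∀ (I J : Type u) [Finite I] [Finite J], ∀ x ∈ W I, ∀ y ∈ W J,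
    H.mul I J (x ⊗ₜ[k] y) ∈ W (I ⊕ J)
  comul_mem : ∀ (I J : Type u) [Finite I] [Finite J], ∀ x ∈ W (I ⊕ J),
    H.comul I J x ∈ LinearMap.range (TensorProduct.mapIncl (W I) (W J))

/-- The Hadamard product of two Hopf monoids, with componentwise operations. -/
def HopfMonoidData.hadamard {k : Type v} [Field k] (H K : HopfMonoidData.{u, v, w} k) :
    HopfMonoidData.{u, v, w} k where
  obj I := H.obj I ⊗[k] K.obj I
  map e := TensorProduct.map (H.map e) (K.map e)
  mul I J := TensorProduct.map (H.mul I J) (K.mul I J) ∘ₗ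
    (TensorProduct.tensorTensorTensorComm k (H.obj I) (K.obj I) (H.obj J) (K.obj J)).toLinearMap
  comul I J :=
    (TensorProduct.tensorTensorTensorComm k (H.obj I) (H.obj J) (K.obj I) (K.obj J)).toLinearMap ∘ₗ
      TensorProduct.map (H.comul I J) (K.comul I J)
  one := H.one ⊗ₜ[k] K.one
  counit := LinearMap.mul' k k ∘ₗ TensorProduct.map H.counit K.counit

/-- The linear map on `k[X] ⊗ k[Y]` given by its values on the basis `X × Y`. -/
def liftTensor (k : Type v) [Field k] {X Y : Type u} {M : Type w} [AddCommGroup M] [Module k M]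
    (f : X → Y → M) : (X →₀ k) ⊗[k] (Y →₀ k) →ₗ[k] M :=
  TensorProduct.lift (Finsupp.lift ((Y →₀ k) →ₗ[k] M) k X fun x => Finsupp.lift M k Y (f x))

/-- The Hopf monoid `L*` of linear orders, with the shuffle product and with the coproduct
`v ↦ v|I ⊗ v|J` if `v|I` is an initial segment of `v`, and `v ↦ 0` otherwise. -/
def Lstar (k : Type v) [Field k] : HopfMonoidData.{u, v, max u v} k where
  obj I := LinearOrd I →₀ k
  map e := Finsupp.lmapDomain k k (LinearOrd.relabel e)
  mul I J := liftTensor k fun (w : LinearOrd I) (t : LinearOrd J) =>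
    ∑ v ∈ (Set.toFinite (shuffles w t)).toFinset, Finsupp.single v 1
  comul I J := Finsupp.lift _ k (LinearOrd (I ⊕ J)) fun v =>
    open scoped Classical in
    if v.LeftInitial then Finsupp.single v.left 1 ⊗ₜ[k] Finsupp.single v.right 1 else 0
  one := Finsupp.single LinearOrd.empty 1
  counit := Finsupp.lift k k (LinearOrd PEmpty) fun _ => 1

/-- The Hopf monoid `GP₊` of extended generalized permutahedra, with product `p × q` and with the
coproduct `p ↦ p|I ⊗ p/I` if `p` is bounded above in the direction of the indicator vector of `I`,
and `p ↦ 0` otherwise. -/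
def GPplus (k : Type v) [Field k] : HopfMonoidData.{u, v, max u v} k where
  obj I := EGP I →₀ k
  map e := Finsupp.lmapDomain k k (EGP.relabel e)
  mul I J := liftTensor k fun (p : EGP I) (q : EGP J) => Finsupp.single (p.prod q) 1
  comul I J := Finsupp.lift _ k (EGP (I ⊕ J)) fun p =>
    open scoped Classical in
    if h : p.BoundedLeft then Finsupp.single (p.restr h) 1 ⊗ₜ[k] Finsupp.single (p.contr h) 1
    else 0
  one := Finsupp.single EGP.point 1
  counit := Finsupp.lift k k (EGP PEmpty) fun _ => 1

/-! ### Ordered extended generalized permutahedra -/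

/-- The two conventions for the braid chamber of a linear order: coordinates increase, or
decrease, along the order. -/
inductive ChamberConvention
  | increasing
  | decreasing

/-- The braid chamber `σ_w` of a linear order `w`, an open cone. -/
def chamber {I : Type u} : ChamberConvention → LinearOrd I → Set (I → ℝ)
  | .increasing, w => {x | ∀ i j, x i < x j ↔ (w.1 i j ∧ i ≠ j)}
  | .decreasing, w => {x | ∀ i j, x j < x i ↔ (w.1 i j ∧ i ≠ j)}

/-- The braid chamber of `w` is contained in the normal fan of `p`. -/
def Compatible (c : ChamberConvention) {I : Type u} (w : LinearOrd I) (p : EGP I) : Prop :=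
  chamber c w ⊆ ⋃₀ normalFan p.1

/-- The set of all points of `p` that maximize every linear functional in `σ`. -/
def maxFace {I : Type u} (p σ : Set (I → ℝ)) : Set (I → ℝ) :=
  {y | y ∈ p ∧ ∀ x ∈ σ, ∀ z ∈ p, dot x z ≤ dot x y}

/-- The tensor `w ⊗ p`, an element of `(L* × GP₊)[I]`. -/
def tensor (k : Type v) [Field k] {I : Type u} [Finite I] (w : LinearOrd I) (p : EGP I) :
    ((Lstar.{u, v} k).hadamard (GPplus k)).obj I :=
  (Finsupp.single w (1 : k) : LinearOrd I →₀ k) ⊗ₜ[k] (Finsupp.single p (1 : k) : EGP I →₀ k)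

/-- `OGP₊[I]`: the subspace of `(L* × GP₊)[I]` spanned by the tensors `w ⊗ p` such that the braid
chamber of `w` is contained in the normal fan of `p`. -/
def OGPplus (k : Type v) [Field k] (c : ChamberConvention) (I : Type u) [Finite I] :
    Submodule k (((Lstar.{u, v} k).hadamard (GPplus k)).obj I) :=
  Submodule.span k {t | ∃ (w : LinearOrd I) (p : EGP I), Compatible c w p ∧ t = tensor k w p}

end OrderedGP

end

/-! The two factors are shown separately to be connected Hopf monoids, and `IsHopfMonoid.hadamard`
combines them. All Hadamard axioms are checked on elements a ⊗ b; the only difficulty is that a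
coproduct of such an element is a sum, which is handled by pairing the two coproducts with
`TensorProduct.map₂`.

For `L*`, products and coproducts are computed on sums over sets of linear orders (`mul_setSum`,
`comul_setSum`). An order on I ⊔ J is a shuffle of exactly one pair of orders, and an order with I
as initial segment is determined by its two restrictions. The axioms thus become equalities of sets
of orders.

For `GP₊`, the decisive fact is that a nonempty face of an extended generalized permutahedron
depends only on the braid face of its direction (`IsEGP.face_eq`). Coassociativity compares two
iterated faces; by `IsEGP.face_face_eq_face_add` both are the face in the direction that is 2 on I,
1 on J and 0 on K, and that face is a product of three factors (`IsEGP.mem_face_restrSet_iff`).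
Compatibility of product and coproduct holds because faces of products are products of faces.

A pair (w, p) is compatible when every x in the chamber of w is bounded above on p. For products
this passes to all shuffles, since an element of the chamber of v restricts to elements of the
chambers of its two parts. For coproducts, boundedness of x on p passes to the face p|I × p/I and
then to both factors. Conversely, vectors in the two smaller chambers glue to one in the chamber of
v after translating the second by a constant, to which p/I is insensitive. The relative position of
1_I and the chamber plays no role, so both chamber conventions work.

Finally, a chamber lies in one braid face, so all its functionals have the same maximizers on p. The
chamber is open, so two maximizers differ by a vector orthogonal to an open set, hence coincide; the
unique maximizer of a functional is a vertex. -/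

noncomputable section

namespace OrderedGP

/-! ### Pairing of tensor products along bilinear maps -/

section MapTwo

variable {k : Type*} [Field k] {A A' B B' C C' D D' P P' Q Q' R : Type*}
  [AddCommGroup A] [Module k A] [AddCommGroup A'] [Module k A'] [AddCommGroup B] [Module k B]
  [AddCommGroup B'] [Module k B'] [AddCommGroup C] [Module k C] [AddCommGroup C'] [Module k C']
  [AddCommGroup D] [Module k D] [AddCommGroup D'] [Module k D'] [AddCommGroup P] [Module k P]
  [AddCommGroup P'] [Module k P'] [AddCommGroup Q] [Module k Q] [AddCommGroup Q'] [Module k Q']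
  [AddCommGroup R] [Module k R]

/-- Two bilinear maps on a pair of tensor products agree if they agree on pure tensors. -/
lemma tensor_bilin_ext {f g : A ⊗[k] B →ₗ[k] C ⊗[k] D →ₗ[k] P}
    (h : ∀ a b c d, f (a ⊗ₜ b) (c ⊗ₜ d) = g (a ⊗ₜ b) (c ⊗ₜ d)) (x : A ⊗[k] B) (y : C ⊗[k] D) :
    f x y = g x y :=
  LinearMap.congr_fun₂ (TensorProduct.ext' fun a b => TensorProduct.ext' fun c d => h a b c d) x y

/-- Naturality of `TensorProduct.map₂`. -/
lemma map_map₂ {φ : A →ₗ[k] B →ₗ[k] P} {ψ : C →ₗ[k] D →ₗ[k] Q} {φ' : A' →ₗ[k] B' →ₗ[k] P'}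
    {ψ' : C' →ₗ[k] D' →ₗ[k] Q'} {f : P →ₗ[k] P'} {g : Q →ₗ[k] Q'} {a : A →ₗ[k] A'}
    {b : B →ₗ[k] B'} {c : C →ₗ[k] C'} {d : D →ₗ[k] D'}
    (h : ∀ x y, f (φ x y) = φ' (a x) (b y)) (h' : ∀ x y, g (ψ x y) = ψ' (c x) (d y))
    (x : A ⊗[k] C) (y : B ⊗[k] D) :
    TensorProduct.map f g (TensorProduct.map₂ φ ψ x y) =
      TensorProduct.map₂ φ' ψ' (TensorProduct.map a c x) (TensorProduct.map b d y) :=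
  tensor_bilin_ext (f := (TensorProduct.map₂ φ ψ).compr₂ (TensorProduct.map f g))
    (g := (TensorProduct.map₂ φ' ψ').compl₁₂ (TensorProduct.map a c) (TensorProduct.map b d))
    (fun x z y t => by simp [h, h']) x y

/-- Needed for coassociativity of Hadamard products, where the associator meets paired coproducts.
-/
lemma assoc_map₂ (φ : A →ₗ[k] B →ₗ[k] P) (ψ : A' →ₗ[k] B' →ₗ[k] Q) (χ : C →ₗ[k] D →ₗ[k] R)
    (x : (A ⊗[k] A') ⊗[k] C) (y : (B ⊗[k] B') ⊗[k] D) :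
    TensorProduct.assoc k P Q R (TensorProduct.map₂ (TensorProduct.map₂ φ ψ) χ x y) =
      TensorProduct.map₂ φ (TensorProduct.map₂ ψ χ) (TensorProduct.assoc k A A' C x)
        (TensorProduct.assoc k B B' D y) := by
  refine tensor_bilin_ext (f := (TensorProduct.map₂ (TensorProduct.map₂ φ ψ) χ).compr₂
      (TensorProduct.assoc k P Q R).toLinearMap)
    (g := (TensorProduct.map₂ φ (TensorProduct.map₂ ψ χ)).compl₁₂
      (TensorProduct.assoc k A A' C).toLinearMap (TensorProduct.assoc k B B' D).toLinearMap)
    (fun x c y d => ?_) x y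
  -- The outer factors c and d are now fixed by precomposing with `· ⊗ c` and `· ⊗ d`, which leaves
  -- bilinear maps on the inner tensor products.
  refine tensor_bilin_ext (f := ((TensorProduct.map₂ (TensorProduct.map₂ φ ψ) χ).compr₂
      (TensorProduct.assoc k P Q R).toLinearMap).compl₁₂ ((TensorProduct.mk k _ _).flip c)
        ((TensorProduct.mk k _ _).flip d))
    (g := ((TensorProduct.map₂ φ (TensorProduct.map₂ ψ χ)).compl₁₂
      (TensorProduct.assoc k A A' C).toLinearMap
        (TensorProduct.assoc k B B' D).toLinearMap).compl₁₂ ((TensorProduct.mk k _ _).flip c)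
        ((TensorProduct.mk k _ _).flip d))
    (fun a a' b b' => by simp) x y

/-- Both sides are additive in each of the four arguments and agree on pure tensors. This moves the
middle interchange past the pairing in the compatibility of product and coproduct. -/
lemma tensorTensorTensorComm_map₂ (φ : A →ₗ[k] B →ₗ[k] P) (ψ : A' →ₗ[k] B' →ₗ[k] P')
    (χ : C →ₗ[k] D →ₗ[k] Q) (ω : C' →ₗ[k] D' →ₗ[k] Q') (x : A ⊗[k] A') (y : B ⊗[k] B')
    (z : C ⊗[k] C') (t : D ⊗[k] D') :
    TensorProduct.tensorTensorTensorComm k P P' Q Q'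
        (TensorProduct.map₂ φ ψ x y ⊗ₜ TensorProduct.map₂ χ ω z t) =
      TensorProduct.map₂ (TensorProduct.map₂ φ χ) (TensorProduct.map₂ ψ ω)
        (TensorProduct.tensorTensorTensorComm k A A' C C' (x ⊗ₜ z))
        (TensorProduct.tensorTensorTensorComm k B B' D D' (y ⊗ₜ t)) := by
  induction x with
  | zero => simp
  | add x x' hx hx' => simp only [TensorProduct.add_tmul, map_add, LinearMap.add_apply, hx, hx']
  | tmul a a' =>
  induction y with
  | zero => simp
  | add y y' hy hy' => simp only [TensorProduct.add_tmul, map_add, hy, hy']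
  | tmul b b' =>
  induction z with
  | zero => simp
  | add z z' hz hz' => simp only [TensorProduct.tmul_add, map_add, LinearMap.add_apply, hz, hz']
  | tmul c c' =>
  induction t with
  | zero => simp
  | add t t' ht ht' => simp only [TensorProduct.tmul_add, map_add, ht, ht']
  | tmul d d' => simp

end MapTwo

/-! ### Hadamard products of connected Hopf monoids -/

section Hadamard

variable {k : Type v} [Field k] (H K : HopfMonoidData.{u, v, w} k)

/-- The bilinear map `(a, b) ↦ a ⊗ b` to the Hadamard product. -/
def HopfMonoidData.pure (I : Type u) [Finite I] :
    H.obj I →ₗ[k] K.obj I →ₗ[k] (H.hadamard K).obj I :=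
  TensorProduct.mk k (H.obj I) (K.obj I)

variable {H K}

lemma hadamard_hom_ext {I : Type u} [Finite I] {M : Type*} [AddCommGroup M] [Module k M]
    {f g : (H.hadamard K).obj I →ₗ[k] M}
    (h : ∀ a b, f (H.pure K I a b) = g (H.pure K I a b)) : f = g :=
  TensorProduct.ext' h

lemma hadamard_map {I J : Type u} [Finite I] [Finite J] (e : I ≃ J) (a : H.obj I) (b : K.obj I) :
    (H.hadamard K).map e (H.pure K I a b) = H.pure K J (H.map e a) (K.map e b) := rfl

lemma hadamard_mul {I J : Type u} [Finite I] [Finite J] (a : H.obj I) (b : K.obj I) (c : H.obj J)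
    (d : K.obj J) :
    (H.hadamard K).mul I J (H.pure K I a b ⊗ₜ H.pure K J c d) =
      H.pure K (I ⊕ J) (H.mul I J (a ⊗ₜ c)) (K.mul I J (b ⊗ₜ d)) := rfl

/-- The two coproducts on the right are in general sums of tensors, so the value cannot be written
with `pure` alone; `map₂` pairs their terms bilinearly. -/
lemma hadamard_comul {I J : Type u} [Finite I] [Finite J] (a : H.obj (I ⊕ J))
    (b : K.obj (I ⊕ J)) :
    (H.hadamard K).comul I J (H.pure K (I ⊕ J) a b) =
      TensorProduct.map₂ (H.pure K I) (H.pure K J) (H.comul I J a) (K.comul I J b) :=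
  tensor_bilin_ext
    (f := (TensorProduct.mk k _ _).compr₂ (TensorProduct.tensorTensorTensorComm k (H.obj I)
      (H.obj J) (K.obj I) (K.obj J)).toLinearMap)
    (g := TensorProduct.map₂ (TensorProduct.mk k (H.obj I) (K.obj I))
      (TensorProduct.mk k (H.obj J) (K.obj J))) (fun _ _ _ _ => rfl) (H.comul I J a) (K.comul I J b)

lemma hadamard_one : (H.hadamard K).one = H.pure K PEmpty H.one K.one := rfl

lemma hadamard_counit (a : H.obj PEmpty) (b : K.obj PEmpty) :
    (H.hadamard K).counit (H.pure K PEmpty a b) = H.counit a * K.counit b := rfl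

/-- The Hadamard product of two connected Hopf monoids is a connected Hopf monoid. -/
theorem IsHopfMonoid.hadamard (hH : IsHopfMonoid H) (hK : IsHopfMonoid K) :
    IsHopfMonoid (H.hadamard K) where
  map_refl I _ := hadamard_hom_ext fun a b => by
    simp [hadamard_map, hH.map_refl, hK.map_refl]
  map_trans e f := hadamard_hom_ext fun a b => by
    simp [hadamard_map, hH.map_trans, hK.map_trans]
  mul_natural {I J I' J' _ _ _ _} e f :=
    TensorProduct.ext <| hadamard_hom_ext fun a b => hadamard_hom_ext fun c d => by
      have h1 := LinearMap.congr_fun (hH.mul_natural e f) (a ⊗ₜ c)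
      have h2 := LinearMap.congr_fun (hK.mul_natural e f) (b ⊗ₜ d)
      simp only [LinearMap.comp_apply, TensorProduct.map_tmul] at h1 h2
      simp [hadamard_map, hadamard_mul, h1, h2]
  comul_natural {I J I' J' _ _ _ _} e f := hadamard_hom_ext fun a b => by
    have h1 := LinearMap.congr_fun (hH.comul_natural e f) a
    have h2 := LinearMap.congr_fun (hK.comul_natural e f) b
    simp only [LinearMap.comp_apply] at h1 h2 ⊢
    rw [hadamard_map, hadamard_comul, h1, h2, hadamard_comul]
    exact (map_map₂ (hadamard_map e) (hadamard_map f) _ _).symm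
  mul_assoc I J L _ _ _ := by
    refine TensorProduct.ext <| TensorProduct.ext <| hadamard_hom_ext fun a b =>
      hadamard_hom_ext fun c d => hadamard_hom_ext fun e f => ?_
    have h1 := LinearMap.congr_fun (hH.mul_assoc I J L) ((a ⊗ₜ c) ⊗ₜ e)
    have h2 := LinearMap.congr_fun (hK.mul_assoc I J L) ((b ⊗ₜ d) ⊗ₜ f)
    simp at h1 h2
    simp [hadamard_map, hadamard_mul, h1, h2]
  comul_assoc I J L _ _ _ := hadamard_hom_ext fun a b => by
    have h1 := LinearMap.congr_fun (hH.comul_assoc I J L) a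
    have h2 := LinearMap.congr_fun (hK.comul_assoc I J L) b
    simp only [LinearMap.comp_apply, LinearEquiv.coe_coe] at h1 h2 ⊢
    -- `map_map₂` turns an iterated coproduct into the pairing of the iterated coproducts of a and
    -- b, so that coassociativity of each factor applies; `assoc_map₂` then moves the associator.
    rw [hadamard_map, hadamard_comul, hadamard_comul,
      map_map₂ (φ' := H.pure K I) (a := LinearMap.id) (b := LinearMap.id) (fun _ _ => rfl)
        hadamard_comul, h1, h2,
      map_map₂ (ψ' := H.pure K L) (c := LinearMap.id) (d := LinearMap.id) hadamard_comul
        (fun _ _ => rfl),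
      assoc_map₂]
  one_mul I _ x := by
    refine LinearMap.congr_fun (f := (H.hadamard K).map (Equiv.emptySum PEmpty I) ∘ₗ
      (H.hadamard K).mul PEmpty I ∘ₗ TensorProduct.mk k _ _ (H.hadamard K).one)
      (g := LinearMap.id) (hadamard_hom_ext fun a b => ?_) x
    simp [hadamard_one, hadamard_mul, hadamard_map, hH.one_mul, hK.one_mul]
  mul_one I _ x := by
    refine LinearMap.congr_fun (f := (H.hadamard K).map (Equiv.sumEmpty I PEmpty) ∘ₗ
      (H.hadamard K).mul I PEmpty ∘ₗ (TensorProduct.mk k _ _).flip (H.hadamard K).one)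
      (g := LinearMap.id) (hadamard_hom_ext fun a b => ?_) x
    simp [hadamard_one, hadamard_mul, hadamard_map, hH.mul_one, hK.mul_one]
  counit_comul I _ x := by
    refine LinearMap.congr_fun (f := (TensorProduct.lid k _).toLinearMap ∘ₗ
      TensorProduct.map (H.hadamard K).counit LinearMap.id ∘ₗ (H.hadamard K).comul PEmpty I ∘ₗ
      (H.hadamard K).map (Equiv.emptySum PEmpty I).symm)
      (g := LinearMap.id) (hadamard_hom_ext fun a b => ?_) x
    simp only [LinearMap.comp_apply, LinearEquiv.coe_coe, LinearMap.id_apply]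
    -- Expanding a and b by counitality of the factors leaves an identity that is bilinear in the
    -- two coproducts, hence checkable on pure tensors.
    conv_rhs => rw [← hH.counit_comul I a, ← hK.counit_comul I b]
    rw [hadamard_map, hadamard_comul, map_map₂ (φ' := LinearMap.mul k k) (ψ' := H.pure K I)
      (c := LinearMap.id) (d := LinearMap.id) hadamard_counit (fun _ _ => rfl)]
    refine tensor_bilin_ext (f := (TensorProduct.map₂ (LinearMap.mul k k) (H.pure K I)).compr₂
      (TensorProduct.lid k _).toLinearMap) (g := (H.pure K I).compl₁₂
      (TensorProduct.lid k _).toLinearMap (TensorProduct.lid k _).toLinearMap)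
      (fun s a t b => ?_) _ _
    simp [mul_smul, smul_comm s t]
  comul_counit I _ x := by
    refine LinearMap.congr_fun (f := (TensorProduct.rid k _).toLinearMap ∘ₗ
      TensorProduct.map LinearMap.id (H.hadamard K).counit ∘ₗ (H.hadamard K).comul I PEmpty ∘ₗ
      (H.hadamard K).map (Equiv.sumEmpty I PEmpty).symm)
      (g := LinearMap.id) (hadamard_hom_ext fun a b => ?_) x
    simp only [LinearMap.comp_apply, LinearEquiv.coe_coe, LinearMap.id_apply]
    conv_rhs => rw [← hH.comul_counit I a, ← hK.comul_counit I b]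
    rw [hadamard_map, hadamard_comul, map_map₂ (ψ' := LinearMap.mul k k) (φ' := H.pure K I)
      (a := LinearMap.id) (b := LinearMap.id) (fun _ _ => rfl) hadamard_counit]
    refine tensor_bilin_ext (f := (TensorProduct.map₂ (H.pure K I) (LinearMap.mul k k)).compr₂
      (TensorProduct.rid k _).toLinearMap) (g := (H.pure K I).compl₁₂
      (TensorProduct.rid k _).toLinearMap (TensorProduct.rid k _).toLinearMap)
      (fun a s b t => ?_) _ _
    simp [mul_smul, smul_comm s t]
  comul_mul A B C D _ _ _ _ :=
    TensorProduct.ext <| hadamard_hom_ext fun a b => hadamard_hom_ext fun c d => by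
      have h1 := LinearMap.congr_fun (hH.comul_mul A B C D) (a ⊗ₜ c)
      have h2 := LinearMap.congr_fun (hK.comul_mul A B C D) (b ⊗ₜ d)
      simp only [LinearMap.comp_apply, LinearEquiv.coe_coe, TensorProduct.map_tmul] at h1 h2
      simp only [LinearMap.compr₂ₛₗ_apply, TensorProduct.mk_apply, LinearMap.comp_apply,
        LinearEquiv.coe_coe, TensorProduct.map_tmul]
      rw [hadamard_mul, hadamard_map, hadamard_comul, h1, h2, hadamard_comul, hadamard_comul,
        tensorTensorTensorComm_map₂]
      -- After the interchange it remains to see, in each tensor slot separately, that the Hadamard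
      -- product of paired tensors is the pairing of the two products.
      refine (map_map₂ (fun x y => ?_) (fun x y => ?_) _ _).symm
      · exact tensor_bilin_ext (f := (TensorProduct.map₂ (H.pure K A) (H.pure K C)).compr₂
          ((H.hadamard K).mul A C)) (g := (H.pure K _).compl₁₂ (H.mul A C) (K.mul A C))
          (fun a b c d => by simp [hadamard_mul]) x y
      · exact tensor_bilin_ext (f := (TensorProduct.map₂ (H.pure K B) (H.pure K D)).compr₂
          ((H.hadamard K).mul B D)) (g := (H.pure K _).compl₁₂ (H.mul B D) (K.mul B D))
          (fun a b c d => by simp [hadamard_mul]) x y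
  comul_one := by
    simp [hadamard_one, hadamard_map, hadamard_comul, hH.comul_one, hK.comul_one]
  counit_mul x y := by
    refine LinearMap.congr_fun₂ (f := (TensorProduct.mk k _ _).compr₂
      ((H.hadamard K).counit ∘ₗ (H.hadamard K).map (Equiv.sumEmpty PEmpty PEmpty) ∘ₗ
        (H.hadamard K).mul PEmpty PEmpty))
      (g := (LinearMap.mul k k).compl₁₂ (H.hadamard K).counit (H.hadamard K).counit)
      (hadamard_hom_ext fun a b => hadamard_hom_ext fun c d => ?_) x y
    simp [hadamard_mul, hadamard_map, hadamard_counit, hH.counit_mul, hK.counit_mul,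
      mul_mul_mul_comm]
  counit_one := by
    simp [hadamard_one, hadamard_counit, hH.counit_one, hK.counit_one]
  connected x := by
    refine LinearMap.congr_fun (f := (H.hadamard K).counit.smulRight (H.hadamard K).one)
      (g := LinearMap.id) (hadamard_hom_ext fun a b => ?_) x
    simp only [LinearMap.smulRight_apply, LinearMap.id_apply]
    conv_rhs => rw [← hH.connected a, ← hK.connected b]
    simp only [hadamard_one, hadamard_counit, map_smul, LinearMap.smul_apply, mul_smul]
    exact smul_comm _ _ _

end Hadamard

/-! ### The Hopf monoid of linear orders -/

namespace LinearOrd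

variable {I J : Type u}

lemma ext_rel {v w : LinearOrd I} (h : ∀ i j, v.1 i j ↔ w.1 i j) : v = w :=
  Subtype.ext (funext₂ fun i j => propext (h i j))

lemma rel_antisymm (v : LinearOrd I) {i j : I} (h : v.1 i j) (h' : v.1 j i) : i = j :=
  v.2.antisymm i j h h'

lemma rel_total (v : LinearOrd I) (i j : I) : v.1 i j ∨ v.1 j i := v.2.total i j

lemma rel_trans (v : LinearOrd I) {i j l : I} (h : v.1 i j) (h' : v.1 j l) : v.1 i l :=
  v.2.trans i j l h h'

lemma LeftInitial.not_rel {v : LinearOrd (I ⊕ J)} (h : v.LeftInitial) (i : I) (j : J) :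
    ¬ v.1 (Sum.inr j) (Sum.inl i) := fun h' => by
  cases v.rel_antisymm (h i j) h'

/-- The ordinal sum of two linear orders. -/
def append (w : LinearOrd I) (t : LinearOrd J) : LinearOrd (I ⊕ J) :=
  ⟨Sum.Lex w.1 t.1,
    { refl := by rintro (i | j) <;> simp [w.2.refl, t.2.refl]
      trans := by
        rintro (i | i) (j | j) (l | l) h h' <;> simp at h h' ⊢
        · exact w.rel_trans h h'
        · exact t.rel_trans h h'
      antisymm := by
        rintro (i | i) (j | j) h h' <;> simp at h h' ⊢
        · exact w.rel_antisymm h h'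
        · exact t.rel_antisymm h h'
      total := by
        rintro (i | i) (j | j) <;> simp
        · exact w.rel_total i j
        · exact t.rel_total i j }⟩

lemma left_append (w : LinearOrd I) (t : LinearOrd J) : (w.append t).left = w :=
  ext_rel fun i j => by simp [append, left, comap, Function.onFun]

lemma right_append (w : LinearOrd I) (t : LinearOrd J) : (w.append t).right = t :=
  ext_rel fun i j => by simp [append, right, comap, Function.onFun]

lemma leftInitial_append (w : LinearOrd I) (t : LinearOrd J) : (w.append t).LeftInitial :=
  fun i j => by simp [append]

/-- All comparisons between I and J are forced, so the two restrictions carry all the information.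
-/
lemma LeftInitial.append_eq {v : LinearOrd (I ⊕ J)} (h : v.LeftInitial) :
    v.left.append v.right = v := by
  refine ext_rel ?_
  rintro (i | i) (j | j)
  · simp [append, left, comap, Function.onFun]
  · simp [append, h i j]
  · simp [append, h.not_rel]
  · simp [append, right, comap, Function.onFun]

lemma LeftInitial.ext {v v' : LinearOrd (I ⊕ J)} (h : v.LeftInitial) (h' : v'.LeftInitial)
    (hl : v.left = v'.left) (hr : v.right = v'.right) : v = v' := by
  rw [← h.append_eq, ← h'.append_eq, hl, hr]

lemma relabel_injective (e : I ≃ J) : Function.Injective (relabel e) := fun v w h =>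
  ext_rel fun i j => by
    have := congrArg (fun v : LinearOrd J => v.1 (e i) (e j)) h
    simpa [relabel, comap, Function.onFun] using this

instance [IsEmpty I] : Subsingleton (LinearOrd I) := ⟨fun _ _ => ext_rel fun i => isEmptyElim i⟩

end LinearOrd

lemma liftTensor_single {k : Type v} [Field k] {X Y : Type u} {M : Type w} [AddCommGroup M]
    [Module k M] (f : X → Y → M) (x : X) (y : Y) :
    liftTensor k f (Finsupp.single x 1 ⊗ₜ Finsupp.single y 1) = f x y := by
  simp [liftTensor]

lemma lift_single_one {k X M : Type*} [Field k] [AddCommGroup M] [Module k M] (f : X → M)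
    (x : X) : Finsupp.lift M k X f (Finsupp.single x 1) = f x := by
  simp

/-! ### Operations of `L*` on basis elements and on sums over sets of orders -/

namespace Lstar

variable {k : Type v} [Field k] {I J : Type u} [Finite I] [Finite J]

variable (k) in
/-- The basis element of a linear order. -/
def of (w : LinearOrd I) : (Lstar.{u, v} k).obj I := Finsupp.single w 1

variable (k) in
/-- The sum of the basis elements in a set of linear orders. -/
def setSum (S : Set (LinearOrd I)) : (Lstar.{u, v} k).obj I :=
  ∑ v ∈ (Set.toFinite S).toFinset, of k v

lemma hom_ext {M : Type*} [AddCommGroup M] [Module k M] {f g : (Lstar.{u, v} k).obj I →ₗ[k] M}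
    (h : ∀ w, f (of k w) = g (of k w)) : f = g :=
  Finsupp.lhom_ext' fun w => LinearMap.ext_ring (h w)

lemma map_of (e : I ≃ J) (w : LinearOrd I) :
    (Lstar.{u, v} k).map e (of k w) = of k (w.relabel e) :=
  Finsupp.mapDomain_single

lemma mul_of (w : LinearOrd I) (t : LinearOrd J) :
    (Lstar.{u, v} k).mul I J (of k w ⊗ₜ of k t) = setSum k (shuffles w t) :=
  liftTensor_single _ w t

lemma comul_of {v : LinearOrd (I ⊕ J)} (h : v.LeftInitial) :
    (Lstar.{u, v} k).comul I J (of k v) = of k v.left ⊗ₜ of k v.right :=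
  (lift_single_one _ v).trans (if_pos h)

lemma comul_of_not {v : LinearOrd (I ⊕ J)} (h : ¬ v.LeftInitial) :
    (Lstar.{u, v} k).comul I J (of k v) = 0 :=
  (lift_single_one _ v).trans (if_neg h)

lemma one_eq : (Lstar.{u, v} k).one = of k LinearOrd.empty := rfl

lemma counit_of (w : LinearOrd PEmpty.{u + 1}) : (Lstar.{u, v} k).counit (of k w) = 1 :=
  lift_single_one _ w

lemma setSum_singleton (w : LinearOrd I) : setSum k {w} = of k w := by
  simp [setSum]

lemma map_setSum {e : I ≃ J} {S : Set (LinearOrd I)} {T : Set (LinearOrd J)}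
    (h : ∀ v, v.relabel e ∈ T ↔ v ∈ S) :
    (Lstar.{u, v} k).map e (setSum k S) = setSum k T := by
  have hs : ∀ v : LinearOrd I, (v.relabel e).relabel e.symm = v := fun v =>
    LinearOrd.ext_rel fun i j => by simp [LinearOrd.relabel, LinearOrd.comap, Function.onFun]
  have hs' : ∀ v : LinearOrd J, (v.relabel e.symm).relabel e = v := fun v =>
    LinearOrd.ext_rel fun i j => by simp [LinearOrd.relabel, LinearOrd.comap, Function.onFun]
  rw [setSum, setSum, map_sum]
  refine Finset.sum_nbij' (LinearOrd.relabel e) (LinearOrd.relabel e.symm) ?_ ?_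
    (fun v _ => hs v) (fun v _ => hs' v) (fun v _ => map_of e v)
  · intro v hv
    simpa [h] using hv
  · intro v hv
    simpa [← h, hs'] using hv

/-- Each order v is a shuffle of exactly one pair, namely its two restrictions. The shuffle products
of different pairs therefore have disjoint supports, and every coefficient is 1. -/
lemma mul_setSum (S : Set (LinearOrd I)) (T : Set (LinearOrd J)) :
    (Lstar.{u, v} k).mul I J (setSum k S ⊗ₜ setSum k T) =
      setSum k {v | v.left ∈ S ∧ v.right ∈ T} := by
  classical
  simp only [setSum, TensorProduct.sum_tmul, TensorProduct.tmul_sum, map_sum, mul_of]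
  rw [Finset.sum_comm, ← Finset.sum_product', Finset.sum_sigma']
  refine Finset.sum_nbij' (fun x => x.2) (fun v => ⟨(v.left, v.right), v⟩) ?_ ?_ ?_ ?_ ?_
  · rintro ⟨⟨w, t⟩, v⟩ h
    simp only [Finset.mem_sigma, Finset.mem_product, Set.Finite.mem_toFinset, shuffles,
      Set.mem_ofPred_eq] at h ⊢
    obtain ⟨⟨h1, h2⟩, rfl, rfl⟩ := h
    exact ⟨h1, h2⟩
  · intro v h
    simpa [shuffles] using h
  · rintro ⟨⟨w, t⟩, v⟩ h
    simp only [Finset.mem_sigma, Finset.mem_product, Set.Finite.mem_toFinset, shuffles,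
      Set.mem_ofPred_eq] at h ⊢
    obtain ⟨-, rfl, rfl⟩ := h
    rfl
  · exact fun _ _ => rfl
  · exact fun _ _ => rfl

/-- Orders in which I is not initial contribute 0, so S need only be described on the others; these
correspond bijectively to pairs of orders by ordinal sum. -/
lemma comul_setSum {S : Set (LinearOrd (I ⊕ J))} {T : Set (LinearOrd I)} {U : Set (LinearOrd J)}
    (h : ∀ v, v.LeftInitial → (v ∈ S ↔ v.left ∈ T ∧ v.right ∈ U)) :
    (Lstar.{u, v} k).comul I J (setSum k S) = setSum k T ⊗ₜ setSum k U := by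
  classical
  simp only [setSum, TensorProduct.sum_tmul, TensorProduct.tmul_sum, map_sum]
  rw [Finset.sum_comm, ← Finset.sum_product', ← Finset.sum_filter_of_ne (p := LinearOrd.LeftInitial)]
  · refine Finset.sum_nbij' (fun v => (v.left, v.right)) (fun x => x.1.append x.2) ?_ ?_ ?_ ?_ ?_
    · intro v hv
      simp only [Finset.mem_filter, Set.Finite.mem_toFinset, Finset.mem_product] at hv ⊢
      exact (h v hv.2).1 hv.1
    · rintro ⟨w, t⟩ hv
      simp only [Finset.mem_filter, Set.Finite.mem_toFinset, Finset.mem_product] at hv ⊢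
      refine ⟨(h _ (LinearOrd.leftInitial_append w t)).2 ?_, LinearOrd.leftInitial_append w t⟩
      rwa [LinearOrd.left_append, LinearOrd.right_append]
    · intro v hv
      exact (Finset.mem_filter.1 hv).2.append_eq
    · rintro ⟨w, t⟩ -
      simp [LinearOrd.left_append, LinearOrd.right_append]
    · intro v hv
      exact comul_of (Finset.mem_filter.1 hv).2
  · intro v _ hv
    by_contra hn
    exact hv (comul_of_not hn)

lemma comul_setSum_eq_zero {S : Set (LinearOrd (I ⊕ J))} (h : ∀ v ∈ S, ¬ v.LeftInitial) :
    (Lstar.{u, v} k).comul I J (setSum k S) = 0 := by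
  rw [setSum, map_sum]
  exact Finset.sum_eq_zero fun v hv => comul_of_not (h v (by simpa using hv))

end Lstar

open Lstar LinearOrd in
/-- `L*` is a connected Hopf monoid. -/
theorem isHopfMonoid_Lstar (k : Type v) [Field k] : IsHopfMonoid (Lstar.{u, v} k) where
  map_refl I _ := Lstar.hom_ext fun w => by
    rw [map_of]
    rfl
  map_trans e f := Lstar.hom_ext fun w => by
    rw [LinearMap.comp_apply, map_of, map_of, map_of]
    rfl
  mul_natural e f := TensorProduct.ext <| Lstar.hom_ext fun w => Lstar.hom_ext fun t => by
    simp only [LinearMap.compr₂ₛₗ_apply, TensorProduct.mk_apply, LinearMap.comp_apply,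
      TensorProduct.map_tmul, map_of, mul_of]
    exact map_setSum fun v => and_congr ((relabel_injective e).eq_iff (a := v.left) (b := w))
      ((relabel_injective f).eq_iff (a := v.right) (b := t))
  comul_natural {I J I' J' _ _ _ _} e f := Lstar.hom_ext fun v => by
    simp only [LinearMap.comp_apply, map_of]
    have hiff : (v.relabel (Equiv.sumCongr e f)).LeftInitial ↔ v.LeftInitial :=
      ⟨fun h i j => by simpa [relabel, comap, Function.onFun] using h (e i) (f j),
        fun h i j => h (e.symm i) (f.symm j)⟩
    by_cases h : v.LeftInitial
    · rw [comul_of (hiff.2 h), comul_of h, TensorProduct.map_tmul, map_of, map_of]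
      rfl
    · rw [comul_of_not (mt hiff.1 h), comul_of_not h, map_zero]
  mul_assoc I J K _ _ _ := TensorProduct.ext <| TensorProduct.ext <| Lstar.hom_ext fun w =>
    Lstar.hom_ext fun t => Lstar.hom_ext fun x => by
      simp only [LinearMap.compr₂ₛₗ_apply, TensorProduct.mk_apply, LinearMap.comp_apply,
        TensorProduct.map_tmul, LinearEquiv.coe_coe, TensorProduct.assoc_tmul, LinearMap.id_apply,
        mul_of]
      -- Both triple products become sums over all orders with prescribed restrictions to I, J and
      -- K.
      rw [← setSum_singleton x, ← setSum_singleton w, mul_setSum, mul_setSum]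
      refine map_setSum fun v => ?_
      exact and_assoc.symm
  comul_assoc I J K _ _ _ := Lstar.hom_ext fun v => by
    simp only [LinearMap.comp_apply, map_of, LinearEquiv.coe_coe]
    set v' := v.relabel (Equiv.sumAssoc I J K)
    -- Both sides say that I precedes J and that both precede K.
    have hiff : (v'.LeftInitial ∧ v'.right.LeftInitial) ↔
        (v.LeftInitial ∧ v.left.LeftInitial) := by
      constructor
      · rintro ⟨h1, h2⟩
        refine ⟨?_, fun i j => h1 i (Sum.inl j)⟩
        rintro (i | j) l
        · exact h1 i (Sum.inr l)
        · exact h2 j l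
      · rintro ⟨h1, h2⟩
        refine ⟨?_, fun j l => h1 (Sum.inr j) l⟩
        rintro i (j | l)
        · exact h2 i j
        · exact h1 (Sum.inl i) l
    by_cases h : v.LeftInitial ∧ v.left.LeftInitial
    · rw [comul_of (hiff.2 h).1, comul_of h.1, TensorProduct.map_tmul, TensorProduct.map_tmul,
        comul_of (hiff.2 h).2, comul_of h.2]
      rfl
    · trans 0
      · by_cases h1 : v'.LeftInitial
        · rw [comul_of h1, TensorProduct.map_tmul,
            comul_of_not fun h2 => h (hiff.1 ⟨h1, h2⟩), TensorProduct.tmul_zero]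
        · rw [comul_of_not h1, map_zero]
      · by_cases h1 : v.LeftInitial
        · rw [comul_of h1, TensorProduct.map_tmul, comul_of_not fun h2 => h ⟨h1, h2⟩,
            TensorProduct.zero_tmul, map_zero]
        · rw [comul_of_not h1, map_zero, map_zero]
  one_mul I _ x := by
    refine LinearMap.congr_fun (f := (Lstar.{u, v} k).map (Equiv.emptySum PEmpty I) ∘ₗ
      (Lstar.{u, v} k).mul PEmpty I ∘ₗ TensorProduct.mk k _ _ (Lstar.{u, v} k).one)
      (g := LinearMap.id) (Lstar.hom_ext fun w => ?_) x
    simp only [LinearMap.comp_apply, TensorProduct.mk_apply, one_eq, mul_of, LinearMap.id_apply]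
    rw [← setSum_singleton w]
    exact map_setSum fun v => ⟨fun h => ⟨Subsingleton.elim _ _, h⟩, fun h => h.2⟩
  mul_one I _ x := by
    refine LinearMap.congr_fun (f := (Lstar.{u, v} k).map (Equiv.sumEmpty I PEmpty) ∘ₗ
      (Lstar.{u, v} k).mul I PEmpty ∘ₗ (TensorProduct.mk k _ _).flip (Lstar.{u, v} k).one)
      (g := LinearMap.id) (Lstar.hom_ext fun w => ?_) x
    simp only [LinearMap.comp_apply, LinearMap.flip_apply, TensorProduct.mk_apply, one_eq, mul_of,
      LinearMap.id_apply]
    rw [← setSum_singleton w]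
    exact map_setSum fun v => ⟨fun h => ⟨h, Subsingleton.elim _ _⟩, fun h => h.1⟩
  counit_comul I _ x := by
    refine LinearMap.congr_fun (f := (TensorProduct.lid k _).toLinearMap ∘ₗ
      TensorProduct.map (Lstar.{u, v} k).counit LinearMap.id ∘ₗ (Lstar.{u, v} k).comul PEmpty I ∘ₗ
      (Lstar.{u, v} k).map (Equiv.emptySum PEmpty I).symm)
      (g := LinearMap.id) (Lstar.hom_ext fun w => ?_) x
    simp only [LinearMap.comp_apply, LinearEquiv.coe_coe, LinearMap.id_apply, map_of]
    rw [comul_of fun i => i.elim, TensorProduct.map_tmul, counit_of, TensorProduct.lid_tmul,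
      one_smul]
    rfl
  comul_counit I _ x := by
    refine LinearMap.congr_fun (f := (TensorProduct.rid k _).toLinearMap ∘ₗ
      TensorProduct.map LinearMap.id (Lstar.{u, v} k).counit ∘ₗ (Lstar.{u, v} k).comul I PEmpty ∘ₗ
      (Lstar.{u, v} k).map (Equiv.sumEmpty I PEmpty).symm)
      (g := LinearMap.id) (Lstar.hom_ext fun w => ?_) x
    simp only [LinearMap.comp_apply, LinearEquiv.coe_coe, LinearMap.id_apply, map_of]
    rw [comul_of fun i j => j.elim, TensorProduct.map_tmul, counit_of, TensorProduct.rid_tmul,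
      one_smul]
    rfl
  comul_mul A B C D _ _ _ _ := TensorProduct.ext <| Lstar.hom_ext fun w =>
    Lstar.hom_ext fun t => by
      simp only [LinearMap.compr₂ₛₗ_apply, TensorProduct.mk_apply, LinearMap.comp_apply,
        LinearEquiv.coe_coe, TensorProduct.map_tmul, mul_of]
      set e := Equiv.sumSumSumComm A B C D
      have he : ∀ v : LinearOrd ((A ⊕ B) ⊕ C ⊕ D), (v.relabel e).relabel e.symm = v := fun v =>
        LinearOrd.ext_rel fun i j => by simp [LinearOrd.relabel, LinearOrd.comap, Function.onFun]
      rw [map_setSum (T := {v | v.relabel e.symm ∈ shuffles w t})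
        fun v => by rw [Set.mem_ofPred_eq, he]]
      by_cases h : w.LeftInitial ∧ t.LeftInitial
      · rw [comul_of h.1, comul_of h.2, TensorProduct.tensorTensorTensorComm_tmul,
          TensorProduct.map_tmul, mul_of, mul_of]
        refine comul_setSum fun v hv => ⟨?_, ?_⟩
        · rintro ⟨rfl, rfl⟩
          exact ⟨⟨rfl, rfl⟩, ⟨rfl, rfl⟩⟩
        · rintro ⟨⟨h1, h2⟩, ⟨h3, h4⟩⟩
          -- Since A ⊔ C is initial in v, A is initial in the restriction to A ⊔ B and C in that to
          -- C ⊔ D; these restrictions are thus determined by their parts.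
          exact ⟨LeftInitial.ext (fun a b => hv (Sum.inl a) (Sum.inl b)) h.1 h1 h3,
            LeftInitial.ext (fun c d => hv (Sum.inr c) (Sum.inr d)) h.2 h2 h4⟩
      · rw [comul_setSum_eq_zero]
        · rw [not_and_or] at h
          obtain h | h := h
          · rw [comul_of_not h, TensorProduct.zero_tmul, map_zero, map_zero]
          · rw [comul_of_not h, TensorProduct.tmul_zero, map_zero, map_zero]
        -- A shuffle with A ⊔ C initial would make A initial in w and C initial in t.
        · rintro v ⟨rfl, rfl⟩ hv
          exact h ⟨fun a b => hv (Sum.inl a) (Sum.inl b), fun c d => hv (Sum.inr c) (Sum.inr d)⟩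
  comul_one := by
    rw [one_eq, map_of, comul_of fun i => i.elim]
    congr 2
  counit_mul x y := by
    refine LinearMap.congr_fun₂ (f := (TensorProduct.mk k _ _).compr₂
      ((Lstar.{u, v} k).counit ∘ₗ (Lstar.{u, v} k).map (Equiv.sumEmpty PEmpty PEmpty) ∘ₗ
        (Lstar.{u, v} k).mul PEmpty PEmpty))
      (g := (LinearMap.mul k k).compl₁₂ (Lstar.{u, v} k).counit (Lstar.{u, v} k).counit)
      (Lstar.hom_ext fun w => Lstar.hom_ext fun t => ?_) x y
    simp only [LinearMap.compr₂_apply, TensorProduct.mk_apply, LinearMap.comp_apply, mul_of,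
      LinearMap.compl₁₂_apply, counit_of, LinearMap.mul_apply', _root_.mul_one]
    rw [map_setSum (T := {LinearOrd.empty}), setSum_singleton, counit_of]
    exact fun v => ⟨fun _ => ⟨Subsingleton.elim _ _, Subsingleton.elim _ _⟩,
      fun _ => Subsingleton.elim _ _⟩
  counit_one := counit_of _
  connected x := by
    refine LinearMap.congr_fun (f := (Lstar.{u, v} k).counit.smulRight (Lstar.{u, v} k).one)
      (g := LinearMap.id) (Lstar.hom_ext fun w => ?_) x
    rw [LinearMap.smulRight_apply, counit_of, one_smul, one_eq,
      Subsingleton.elim LinearOrd.empty w, LinearMap.id_apply]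

/-! ### The Hopf monoid of extended generalized permutahedra -/

lemma face_zero {I : Type u} (p : Set (I → ℝ)) : face p 0 = p := by
  simp [face, zero_dot]

/-- If all positive combinations of `x` and `y` lie in one face of the braid arrangement, then the
face of an extended generalized permutahedron in direction `x + y` is an iterated face. -/
lemma IsEGP.face_face_eq_face_add {I : Type u} [Finite I] {p : Set (I → ℝ)} (hp : IsEGP p)
    {x y : I → ℝ}
    (h : ∀ C : ℝ, 0 < C → y + C • x ∈ braidFace (x + y)) :
    face (face p x) y = face p (x + y) := by
  -- For large C the iterated face is the face in direction y + C x, whose braid face is that of x +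
  -- y.
  have key : (face (face p x) y).Nonempty → face (face p x) y = face p (x + y) := fun hne => by
    obtain ⟨C0, hC0⟩ := face_face hp.1 x y hne
    have h0 := hC0 (max C0 0 + 1) (by linarith [le_max_left C0 0])
    have hb := h (max C0 0 + 1) (by linarith [le_max_right C0 0])
    have := hp.face_eq (x := y + (max C0 0 + 1) • x) (y := x + y)
      (fun i j => (hb i j).symm) (by rwa [h0])
    rw [this, h0]
  by_cases hne : (face (face p x) y).Nonempty
  · exact key hne
  by_cases hne' : (face p (x + y)).Nonempty
  · refine key ?_
    -- Every y + C x with C > 0 is nonpositive on the recession directions R; letting C grow shows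
    -- that x is too, so the face in direction x is nonempty.
    obtain ⟨R, hR⟩ := exists_recession hp.1 hp.2.1
    have hx : (face p x).Nonempty := (hR x).2 fun z hz => by
      have h1 : ∀ C : ℝ, 0 < C → dot y z + C * dot x z ≤ 0 := fun C hC => by
        have := (hR _).1 (by rwa [hp.face_eq (h C hC) hne']) z hz
        rwa [add_dot, smul_dot] at this
      by_contra hn
      push Not at hn
      -- This C makes the second summand |y · z| + 1, so the sum is positive.
      have h2 := h1 ((|dot y z| + 1) / dot x z) (by positivity)
      rw [div_mul_cancel₀ _ hn.ne'] at h2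
      linarith [neg_abs_le (dot y z)]
    obtain ⟨t, ht⟩ := hne'
    obtain ⟨s, hs⟩ := hx
    -- On the face in direction x the functional x takes the constant value x · s, so a bound for x
    -- + y on p bounds y there.
    refine face_nonempty_of_le (hp.1.face x ⟨s, hs⟩) ⟨s, hs⟩ y (dot (x + y) t - dot x s)
      fun z hz => ?_
    have h1 := ht.2 z hz.1
    have h2 := hz.2 s hs.1
    rw [add_dot x y z] at h1
    linarith
  · rw [Set.not_nonempty_iff_eq_empty.1 hne, Set.not_nonempty_iff_eq_empty.1 hne']

/-- The sum of the coordinates in I is constant on p|I, because its points come from points of p at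
which this sum is maximal. -/
lemma face_restrSet_one {I J : Type u} [Finite I] [Finite J] (p : Set (I ⊕ J → ℝ)) :
    face (restrSet p) 1 = restrSet p := by
  refine Set.ext fun _ => ⟨fun h => h.1, fun h => ⟨h, ?_⟩⟩
  obtain ⟨y, hy, rfl⟩ := h
  rintro _ ⟨z, hz, rfl⟩
  simpa [dot_sum, indicatorLeft, zero_dot] using hy.2 z hz.1

/-- The two ways to iterate restriction and contraction along `I ⊔ J ⊔ K` give the same face. -/
lemma IsEGP.mem_face_restrSet_iff {I J K : Type u} [Finite I] [Finite J] [Finite K]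
    {p : Set ((I ⊕ J) ⊕ K → ℝ)} (hp : IsEGP p) (a : I → ℝ) (b : J → ℝ) (c : K → ℝ) :
    (Sum.elim a b ∈ face (restrSet p) (indicatorLeft I J) ∧ c ∈ contrSet p) ↔
      (a ∈ restrSet (relabelSet (Equiv.sumAssoc I J K) p) ∧
        Sum.elim b c ∈ face (contrSet (relabelSet (Equiv.sumAssoc I J K) p))
          (indicatorLeft J K)) := by
  -- The directions (1, 1, 0) and (1, 0, 0) on I, J, K add up to (2, 1, 0).
  have h1 := hp.face_face_eq_face_add (x := indicatorLeft (I ⊕ J) K)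
    (y := Sum.elim (indicatorLeft I J) 0) (fun C hC => by
      rintro ((i | i) | i) ((j | j) | j) <;> simp [indicatorLeft] <;>
        first | linarith | (constructor <;> intro h <;> linarith))
  -- Here the second direction is (1, 1, 0) rather than (0, 1, 0): the sum is again (2, 1, 0), and
  -- adding any C > 0 times (1, 0, 0) keeps I above J. The extra 1 on I does not change the iterated
  -- face, by `face_restrSet_one`.
  have h2 := (hp.relabel (Equiv.sumAssoc I J K)).face_face_eq_face_add
    (x := indicatorLeft I (J ⊕ K)) (y := Sum.elim 1 (indicatorLeft J K)) (fun C hC => by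
      rintro (i | i | i) (j | j | j) <;> simp [indicatorLeft] <;>
        first | linarith | (constructor <;> intro h <;> linarith))
  rw [hp.face_eq_prodSet, face_prodSet, Sum.elim_comp_inl, Sum.elim_comp_inr, face_zero] at h1
  rw [(hp.relabel (Equiv.sumAssoc I J K)).face_eq_prodSet, face_prodSet, Sum.elim_comp_inl,
    Sum.elim_comp_inr, face_restrSet_one, face_relabelSet] at h2
  have h3 : (indicatorLeft I (J ⊕ K) + Sum.elim (1 : I → ℝ) (indicatorLeft J K)) ∘
      Equiv.sumAssoc I J K =
      indicatorLeft (I ⊕ J) K + Sum.elim (indicatorLeft I J) 0 := by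
    ext ((i | i) | i) <;> simp [indicatorLeft]
  rw [h3, ← h1] at h2
  have h4 := Set.ext_iff.1 h2 (Sum.elim a (Sum.elim b c))
  refine Iff.trans ?_ h4.symm
  have h5 : (Sum.elim a (Sum.elim b c) : I ⊕ J ⊕ K → ℝ) ∘ Equiv.sumAssoc I J K =
      Sum.elim (Sum.elim a b) c := by
    ext ((i | i) | i) <;> rfl
  simp [relabelSet, prodSet, h5]

/-! ### Restriction and contraction under relabelling -/

section Relabel

variable {I J I' J' : Type u}

lemma face_relabelSet_sumCongr (e : I ≃ I') (f : J ≃ J') (p : Set (I ⊕ J → ℝ)) :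
    face (relabelSet (Equiv.sumCongr e f) p) (indicatorLeft I' J') =
      relabelSet (Equiv.sumCongr e f) (face p (indicatorLeft I J)) := by
  rw [face_relabelSet]
  congr 2
  ext (i | i) <;> rfl

lemma mem_restrSet_iff {p : Set (I ⊕ J → ℝ)} {x : I → ℝ} :
    x ∈ restrSet p ↔ ∃ y, Sum.elim x y ∈ face p (indicatorLeft I J) := by
  constructor
  · rintro ⟨z, hz, rfl⟩
    exact ⟨z ∘ Sum.inr, by rwa [Sum.elim_comp_inl_inr]⟩
  · rintro ⟨y, hy⟩
    exact ⟨_, hy, Sum.elim_comp_inl _ _⟩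

lemma mem_contrSet_iff {p : Set (I ⊕ J → ℝ)} {y : J → ℝ} :
    y ∈ contrSet p ↔ ∃ x, Sum.elim x y ∈ face p (indicatorLeft I J) := by
  constructor
  · rintro ⟨z, hz, rfl⟩
    exact ⟨z ∘ Sum.inl, by rwa [Sum.elim_comp_inl_inr]⟩
  · rintro ⟨x, hx⟩
    exact ⟨_, hx, Sum.elim_comp_inr _ _⟩

lemma nonempty_relabelSet {e : I ≃ J} {p : Set (I → ℝ)} :
    (relabelSet e p).Nonempty ↔ p.Nonempty :=
  ⟨fun ⟨y, hy⟩ => ⟨_, hy⟩, fun ⟨y, hy⟩ =>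
    ⟨y ∘ e.symm, by simpa [relabelSet, Function.comp_assoc] using hy⟩⟩

lemma restrSet_relabelSet (e : I ≃ I') (f : J ≃ J') (p : Set (I ⊕ J → ℝ)) :
    restrSet (relabelSet (Equiv.sumCongr e f) p) = relabelSet e (restrSet p) := by
  ext x
  simp only [relabelSet, Set.mem_ofPred_eq, mem_restrSet_iff]
  rw [← relabelSet, face_relabelSet_sumCongr]
  constructor
  · rintro ⟨y, hy⟩
    refine ⟨y ∘ f, ?_⟩
    have h : Sum.elim (x ∘ e) (y ∘ f) = Sum.elim x y ∘ Equiv.sumCongr e f := by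
      ext (i | i) <;> rfl
    rwa [h]
  · rintro ⟨y, hy⟩
    refine ⟨y ∘ f.symm, ?_⟩
    simp only [relabelSet, Set.mem_ofPred_eq]
    convert hy using 1
    ext (i | i) <;> simp

lemma contrSet_relabelSet (e : I ≃ I') (f : J ≃ J') (p : Set (I ⊕ J → ℝ)) :
    contrSet (relabelSet (Equiv.sumCongr e f) p) = relabelSet f (contrSet p) := by
  ext x
  simp only [relabelSet, Set.mem_ofPred_eq, mem_contrSet_iff]
  rw [← relabelSet, face_relabelSet_sumCongr]
  constructor
  · rintro ⟨y, hy⟩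
    refine ⟨y ∘ e, ?_⟩
    have h : Sum.elim (y ∘ e) (x ∘ f) = Sum.elim y x ∘ Equiv.sumCongr e f := by
      ext (i | i) <;> rfl
    rwa [h]
  · rintro ⟨y, hy⟩
    refine ⟨y ∘ e.symm, ?_⟩
    simp only [relabelSet, Set.mem_ofPred_eq]
    convert hy using 1
    ext (i | i) <;> simp

end Relabel

/-! ### Restriction and contraction of Cartesian products -/

section Product

variable {A B C D : Type u} [Finite A] [Finite B] [Finite C] [Finite D]

/-- The indicator vector of A ⊔ C restricts to those of A in A ⊔ B and of C in C ⊔ D, so the face of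
the product splits. -/
lemma mem_face_relabelSet_prodSet {p : Set (A ⊕ B → ℝ)} {q : Set (C ⊕ D → ℝ)}
    {x : A ⊕ C → ℝ} {y : B ⊕ D → ℝ} :
    Sum.elim x y ∈ face (relabelSet (Equiv.sumSumSumComm A B C D) (prodSet p q))
        (indicatorLeft (A ⊕ C) (B ⊕ D)) ↔
      Sum.elim (x ∘ Sum.inl) (y ∘ Sum.inl) ∈ face p (indicatorLeft A B) ∧
        Sum.elim (x ∘ Sum.inr) (y ∘ Sum.inr) ∈ face q (indicatorLeft C D) := by
  rw [face_relabelSet, relabelSet, Set.mem_ofPred_eq, face_prodSet, prodSet, Set.mem_ofPred_eq]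
  set e := Equiv.sumSumSumComm A B C D
  have h1 : (indicatorLeft (A ⊕ C) (B ⊕ D) ∘ e) ∘ Sum.inl = indicatorLeft A B := by
    ext (i | i) <;> rfl
  have h2 : (indicatorLeft (A ⊕ C) (B ⊕ D) ∘ e) ∘ Sum.inr = indicatorLeft C D := by
    ext (i | i) <;> rfl
  have h3 : (Sum.elim x y ∘ e) ∘ Sum.inl = Sum.elim (x ∘ Sum.inl) (y ∘ Sum.inl) := by
    ext (i | i) <;> rfl
  have h4 : (Sum.elim x y ∘ e) ∘ Sum.inr = Sum.elim (x ∘ Sum.inr) (y ∘ Sum.inr) := by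
    ext (i | i) <;> rfl
  rw [h1, h2, h3, h4]

lemma restrSet_prodSet (p : Set (A ⊕ B → ℝ)) (q : Set (C ⊕ D → ℝ)) :
    restrSet (relabelSet (Equiv.sumSumSumComm A B C D) (prodSet p q)) =
      prodSet (restrSet p) (restrSet q) := by
  ext x
  simp only [prodSet, Set.mem_ofPred_eq, mem_restrSet_iff]
  rw [← prodSet]
  simp only [mem_face_relabelSet_prodSet]
  exact ⟨fun ⟨y, h1, h2⟩ => ⟨⟨_, h1⟩, ⟨_, h2⟩⟩, fun ⟨⟨y, h1⟩, ⟨z, h2⟩⟩ => ⟨Sum.elim y z, h1, h2⟩⟩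

lemma contrSet_prodSet (p : Set (A ⊕ B → ℝ)) (q : Set (C ⊕ D → ℝ)) :
    contrSet (relabelSet (Equiv.sumSumSumComm A B C D) (prodSet p q)) =
      prodSet (contrSet p) (contrSet q) := by
  ext x
  simp only [prodSet, Set.mem_ofPred_eq, mem_contrSet_iff]
  rw [← prodSet]
  simp only [mem_face_relabelSet_prodSet]
  exact ⟨fun ⟨y, h1, h2⟩ => ⟨⟨_, h1⟩, ⟨_, h2⟩⟩, fun ⟨⟨y, h1⟩, ⟨z, h2⟩⟩ => ⟨Sum.elim y z, h1, h2⟩⟩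

end Product

namespace EGP

variable {I J : Type u}

lemma boundedLeft_iff {p : EGP (I ⊕ J)} :
    p.BoundedLeft ↔ ∃ x y, Sum.elim x y ∈ face p.1 (indicatorLeft I J) :=
  ⟨fun ⟨z, hz⟩ => ⟨z ∘ Sum.inl, z ∘ Sum.inr, by rwa [Sum.elim_comp_inl_inr]⟩,
    fun ⟨_, _, h⟩ => ⟨_, h⟩⟩

lemma boundedLeft_of_mem_restr {p : EGP (I ⊕ J)} {x : I → ℝ} (h : x ∈ restrSet p.1) :
    p.BoundedLeft :=
  let ⟨_, hy⟩ := mem_restrSet_iff.1 h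
  ⟨_, hy⟩

lemma boundedLeft_of_mem_contr {p : EGP (I ⊕ J)} {y : J → ℝ} (h : y ∈ contrSet p.1) :
    p.BoundedLeft :=
  let ⟨_, hx⟩ := mem_contrSet_iff.1 h
  ⟨_, hx⟩

/-- The space ℝ^∅ is a single point, so a nonempty subset is everything. This is the source of
connectedness. -/
instance [IsEmpty I] : Subsingleton (EGP I) :=
  ⟨fun p q => Subtype.ext ((Subsingleton.eq_univ_of_nonempty p.2.2.1).trans
    (Subsingleton.eq_univ_of_nonempty q.2.2.1).symm)⟩

end EGP

/-! ### Operations of `GP₊` on basis elements -/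

namespace GPplus

variable {k : Type v} [Field k] {I J : Type u} [Finite I] [Finite J]

variable (k) in
/-- The basis element of an extended generalized permutahedron. -/
def of (p : EGP I) : (GPplus.{u, v} k).obj I := Finsupp.single p 1

lemma hom_ext {M : Type*} [AddCommGroup M] [Module k M] {f g : (GPplus.{u, v} k).obj I →ₗ[k] M}
    (h : ∀ p, f (of k p) = g (of k p)) : f = g :=
  Finsupp.lhom_ext' fun p => LinearMap.ext_ring (h p)

lemma map_of (e : I ≃ J) (p : EGP I) :
    (GPplus.{u, v} k).map e (of k p) = of k (p.relabel e) :=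
  Finsupp.mapDomain_single

lemma mul_of (p : EGP I) (q : EGP J) :
    (GPplus.{u, v} k).mul I J (of k p ⊗ₜ of k q) = of k (p.prod q) :=
  liftTensor_single _ p q

lemma comul_of {p : EGP (I ⊕ J)} (h : p.BoundedLeft) :
    (GPplus.{u, v} k).comul I J (of k p) = of k (p.restr h) ⊗ₜ of k (p.contr h) :=
  (lift_single_one _ p).trans (dif_pos h)

lemma comul_of_not {p : EGP (I ⊕ J)} (h : ¬ p.BoundedLeft) :
    (GPplus.{u, v} k).comul I J (of k p) = 0 :=
  (lift_single_one _ p).trans (dif_neg h)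

lemma one_eq : (GPplus.{u, v} k).one = of k EGP.point := rfl

lemma counit_of (p : EGP PEmpty.{u + 1}) : (GPplus.{u, v} k).counit (of k p) = 1 :=
  lift_single_one _ p

end GPplus

open GPplus EGP in
/-- `GP₊` is a connected Hopf monoid. -/
theorem isHopfMonoid_GPplus (k : Type v) [Field k] : IsHopfMonoid (GPplus.{u, v} k) where
  map_refl I _ := GPplus.hom_ext fun p => by
    rw [map_of]
    rfl
  map_trans e f := GPplus.hom_ext fun p => by
    rw [LinearMap.comp_apply, map_of, map_of, map_of]
    rfl
  mul_natural e f := TensorProduct.ext <| GPplus.hom_ext fun p => GPplus.hom_ext fun q => by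
    simp only [LinearMap.compr₂ₛₗ_apply, TensorProduct.mk_apply, LinearMap.comp_apply,
      TensorProduct.map_tmul, map_of, mul_of]
    rfl
  comul_natural {I J I' J' _ _ _ _} e f := GPplus.hom_ext fun p => by
    simp only [LinearMap.comp_apply, map_of]
    have hiff : (p.relabel (Equiv.sumCongr e f)).BoundedLeft ↔ p.BoundedLeft := by
      rw [BoundedLeft, EGP.relabel, face_relabelSet_sumCongr, nonempty_relabelSet, BoundedLeft]
    by_cases h : p.BoundedLeft
    · rw [comul_of (hiff.2 h), comul_of h, TensorProduct.map_tmul, map_of, map_of]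
      congr 2
      · exact Subtype.ext (restrSet_relabelSet e f p.1)
      · exact Subtype.ext (contrSet_relabelSet e f p.1)
    · rw [comul_of_not (mt hiff.1 h), comul_of_not h, map_zero]
  mul_assoc I J K _ _ _ := TensorProduct.ext <| TensorProduct.ext <| GPplus.hom_ext fun p =>
    GPplus.hom_ext fun q => GPplus.hom_ext fun r => by
      simp only [LinearMap.compr₂ₛₗ_apply, TensorProduct.mk_apply, LinearMap.comp_apply,
        TensorProduct.map_tmul, LinearEquiv.coe_coe, TensorProduct.assoc_tmul, LinearMap.id_apply,
        mul_of, map_of]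
      exact congrArg (of k) (Subtype.ext (Set.ext fun _ => and_assoc))
  comul_assoc I J K _ _ _ := GPplus.hom_ext fun p => by
    simp only [LinearMap.comp_apply, map_of, LinearEquiv.coe_coe]
    set p' := p.relabel (Equiv.sumAssoc I J K)
    have key := p.2.mem_face_restrSet_iff
    -- Such a triple is a point of the common iterated face. If one exists, no coproduct involved
    -- vanishes, and fixing two of its three coordinates in `key` identifies each factor. If none
    -- exists, both composites are 0.
    by_cases h : ∃ a b c, Sum.elim a b ∈ face (restrSet p.1) (indicatorLeft I J) ∧ c ∈ contrSet p.1
    · obtain ⟨a, b, c, h⟩ := h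
      have h' := (key a b c).1 h
      have hb : p.BoundedLeft := boundedLeft_of_mem_contr h.2
      have hb' : p'.BoundedLeft := boundedLeft_of_mem_restr (p := p') h'.1
      have hbr : (p.restr hb).BoundedLeft := ⟨_, h.1⟩
      have hbc : (p'.contr hb').BoundedLeft := ⟨_, h'.2⟩
      have e1 : p'.restr hb' = (p.restr hb).restr hbr := by
        refine Subtype.ext (Set.ext fun x => Iff.trans ?_ mem_restrSet_iff.symm)
        exact ⟨fun hx => ⟨b, ((key x b c).2 ⟨hx, h'.2⟩).1⟩,
          fun ⟨y, hy⟩ => ((key x y c).1 ⟨hy, h.2⟩).1⟩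
      have e2 : (p'.contr hb').restr hbc = (p.restr hb).contr hbr := by
        refine Subtype.ext (Set.ext fun y =>
          mem_restrSet_iff.trans (Iff.trans ?_ mem_contrSet_iff.symm))
        exact ⟨fun ⟨z, hz⟩ => ⟨a, ((key a y z).2 ⟨h'.1, hz⟩).1⟩,
          fun ⟨x, hx⟩ => ⟨c, ((key x y c).1 ⟨hx, h.2⟩).2⟩⟩
      have e3 : (p'.contr hb').contr hbc = p.contr hb := by
        refine Subtype.ext (Set.ext fun z => mem_contrSet_iff.trans ?_)
        exact ⟨fun ⟨y, hy⟩ => ((key a y z).2 ⟨h'.1, hy⟩).2,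
          fun hz => ⟨b, ((key a b z).1 ⟨h.1, hz⟩).2⟩⟩
      rw [comul_of hb, comul_of hb', TensorProduct.map_tmul, TensorProduct.map_tmul,
        comul_of hbr, comul_of hbc, TensorProduct.assoc_tmul, e1, e2, e3]
      rfl
    · trans 0
      · by_cases h1 : p'.BoundedLeft
        · rw [comul_of h1, TensorProduct.map_tmul, comul_of_not, TensorProduct.tmul_zero]
          intro h2
          obtain ⟨b, c, hbc⟩ := boundedLeft_iff.1 h2
          obtain ⟨y, hy⟩ := h1
          exact h ⟨_, b, c, (key _ b c).2 ⟨⟨y, hy, rfl⟩, hbc⟩⟩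
        · rw [comul_of_not h1, map_zero]
      · by_cases h1 : p.BoundedLeft
        · rw [comul_of h1, TensorProduct.map_tmul, comul_of_not, TensorProduct.zero_tmul, map_zero]
          intro h2
          obtain ⟨a, b, hab⟩ := boundedLeft_iff.1 h2
          obtain ⟨y, hy⟩ := h1
          exact h ⟨a, b, _, hab, ⟨y, hy, rfl⟩⟩
        · rw [comul_of_not h1, map_zero, map_zero]
  one_mul I _ x := by
    refine LinearMap.congr_fun (f := (GPplus.{u, v} k).map (Equiv.emptySum PEmpty I) ∘ₗ
      (GPplus.{u, v} k).mul PEmpty I ∘ₗ TensorProduct.mk k _ _ (GPplus.{u, v} k).one)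
      (g := LinearMap.id) (GPplus.hom_ext fun p => ?_) x
    simp only [LinearMap.comp_apply, TensorProduct.mk_apply, one_eq, mul_of, map_of,
      LinearMap.id_apply]
    exact congrArg (of k) (Subtype.ext (Set.ext fun _ => and_iff_right trivial))
  mul_one I _ x := by
    refine LinearMap.congr_fun (f := (GPplus.{u, v} k).map (Equiv.sumEmpty I PEmpty) ∘ₗ
      (GPplus.{u, v} k).mul I PEmpty ∘ₗ (TensorProduct.mk k _ _).flip (GPplus.{u, v} k).one)
      (g := LinearMap.id) (GPplus.hom_ext fun p => ?_) x
    simp only [LinearMap.comp_apply, LinearMap.flip_apply, TensorProduct.mk_apply, one_eq, mul_of,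
      map_of, LinearMap.id_apply]
    exact congrArg (of k) (Subtype.ext (Set.ext fun _ => and_iff_left trivial))
  counit_comul I _ x := by
    refine LinearMap.congr_fun (f := (TensorProduct.lid k _).toLinearMap ∘ₗ
      TensorProduct.map (GPplus.{u, v} k).counit LinearMap.id ∘ₗ
      (GPplus.{u, v} k).comul PEmpty I ∘ₗ (GPplus.{u, v} k).map (Equiv.emptySum PEmpty I).symm)
      (g := LinearMap.id) (GPplus.hom_ext fun p => ?_) x
    simp only [LinearMap.comp_apply, LinearEquiv.coe_coe, LinearMap.id_apply, map_of]
    -- The indicator vector of the empty set vanishes, so the face is the whole polyhedron.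
    have h0 : indicatorLeft PEmpty I = 0 := by ext (i | i); exacts [i.elim, rfl]
    have hf : face (p.relabel (Equiv.emptySum PEmpty I).symm).1 (indicatorLeft PEmpty I) =
        (p.relabel (Equiv.emptySum PEmpty I).symm).1 := by rw [h0, face_zero]
    rw [comul_of (by rw [BoundedLeft, hf]; exact (p.relabel _).2.2.1), TensorProduct.map_tmul,
      counit_of, TensorProduct.lid_tmul, one_smul]
    refine congrArg (of k) (Subtype.ext (Set.ext fun y => mem_contrSet_iff.trans ?_))
    rw [hf]
    exact ⟨fun ⟨_, h⟩ => h, fun h => ⟨0, h⟩⟩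
  comul_counit I _ x := by
    refine LinearMap.congr_fun (f := (TensorProduct.rid k _).toLinearMap ∘ₗ
      TensorProduct.map LinearMap.id (GPplus.{u, v} k).counit ∘ₗ
      (GPplus.{u, v} k).comul I PEmpty ∘ₗ (GPplus.{u, v} k).map (Equiv.sumEmpty I PEmpty).symm)
      (g := LinearMap.id) (GPplus.hom_ext fun p => ?_) x
    simp only [LinearMap.comp_apply, LinearEquiv.coe_coe, LinearMap.id_apply, map_of]
    have hf : face (p.relabel (Equiv.sumEmpty I PEmpty).symm).1 (indicatorLeft I PEmpty) =
        (p.relabel (Equiv.sumEmpty I PEmpty).symm).1 := by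
      -- Here the indicator vector is constant with value 1; it lies in the braid face of 0, so the
      -- face is again the whole polyhedron.
      rw [(p.relabel _).2.face_eq (x := 0), face_zero]
      · rintro (i | i) (j | j)
        exacts [by simp [indicatorLeft], j.elim, i.elim, i.elim]
      · rw [face_zero]
        exact (p.relabel _).2.2.1
    rw [comul_of (by rw [BoundedLeft, hf]; exact (p.relabel _).2.2.1), TensorProduct.map_tmul,
      counit_of, TensorProduct.rid_tmul, one_smul]
    refine congrArg (of k) (Subtype.ext (Set.ext fun y => mem_restrSet_iff.trans ?_))
    rw [hf]
    exact ⟨fun ⟨_, h⟩ => h, fun h => ⟨0, h⟩⟩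
  comul_mul A B C D _ _ _ _ := TensorProduct.ext <| GPplus.hom_ext fun p =>
    GPplus.hom_ext fun q => by
      simp only [LinearMap.compr₂ₛₗ_apply, TensorProduct.mk_apply, LinearMap.comp_apply,
        LinearEquiv.coe_coe, TensorProduct.map_tmul, mul_of, map_of]
      have hiff : ((p.prod q).relabel (Equiv.sumSumSumComm A B C D)).BoundedLeft ↔
          p.BoundedLeft ∧ q.BoundedLeft := by
        constructor
        · intro h
          obtain ⟨x, y, hxy⟩ := boundedLeft_iff.1 h
          have := mem_face_relabelSet_prodSet.1 hxy
          exact ⟨⟨_, this.1⟩, ⟨_, this.2⟩⟩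
        · rintro ⟨h1, h2⟩
          obtain ⟨x, y, hxy⟩ := boundedLeft_iff.1 h1
          obtain ⟨z, t, hzt⟩ := boundedLeft_iff.1 h2
          exact ⟨Sum.elim (Sum.elim x z) (Sum.elim y t), mem_face_relabelSet_prodSet.2 ⟨hxy, hzt⟩⟩
      by_cases h : p.BoundedLeft ∧ q.BoundedLeft
      · rw [comul_of (hiff.2 h), comul_of h.1, comul_of h.2,
          TensorProduct.tensorTensorTensorComm_tmul, TensorProduct.map_tmul, mul_of, mul_of]
        congr 2
        · exact Subtype.ext (restrSet_prodSet p.1 q.1)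
        · exact Subtype.ext (contrSet_prodSet p.1 q.1)
      · rw [comul_of_not (mt hiff.1 h)]
        rw [not_and_or] at h
        obtain h | h := h
        · rw [comul_of_not h, TensorProduct.zero_tmul, map_zero, map_zero]
        · rw [comul_of_not h, TensorProduct.tmul_zero, map_zero, map_zero]
  comul_one := by
    rw [one_eq, map_of, comul_of]
    · congr 2
      · exact Subsingleton.elim _ _
      · exact Subsingleton.elim _ _
    · rw [BoundedLeft, Subsingleton.elim (indicatorLeft PEmpty PEmpty) 0, face_zero]
      exact (EGP.relabel _ _).2.2.1
  counit_mul x y := by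
    refine LinearMap.congr_fun₂ (f := (TensorProduct.mk k _ _).compr₂
      ((GPplus.{u, v} k).counit ∘ₗ (GPplus.{u, v} k).map (Equiv.sumEmpty PEmpty PEmpty) ∘ₗ
        (GPplus.{u, v} k).mul PEmpty PEmpty))
      (g := (LinearMap.mul k k).compl₁₂ (GPplus.{u, v} k).counit (GPplus.{u, v} k).counit)
      (GPplus.hom_ext fun p => GPplus.hom_ext fun q => ?_) x y
    simp only [LinearMap.compr₂_apply, TensorProduct.mk_apply, LinearMap.comp_apply, mul_of,
      map_of, LinearMap.compl₁₂_apply, counit_of, LinearMap.mul_apply', _root_.mul_one]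
  counit_one := counit_of _
  connected x := by
    refine LinearMap.congr_fun (f := (GPplus.{u, v} k).counit.smulRight (GPplus.{u, v} k).one)
      (g := LinearMap.id) (GPplus.hom_ext fun p => ?_) x
    rw [LinearMap.smulRight_apply, counit_of, one_smul, one_eq,
      Subsingleton.elim EGP.point p, LinearMap.id_apply]

/-! ### Braid chambers -/

section Chamber

variable {I J : Type u}

/-- Negation exchanges the two conventions and reduces statements on chambers to the increasing one.
-/
lemma mem_chamber_decreasing {w : LinearOrd I} {x : I → ℝ} :
    x ∈ chamber .decreasing w ↔ -x ∈ chamber .increasing w := by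
  simp [chamber]

/-- One implication suffices because w is total: two coordinates in the wrong order would violate
it. -/
lemma mem_chamber_increasing {w : LinearOrd I} {x : I → ℝ} :
    x ∈ chamber .increasing w ↔ ∀ i j, w.1 i j → i ≠ j → x i < x j := by
  refine ⟨fun h i j h1 h2 => (h i j).2 ⟨h1, h2⟩,
    fun h i j => ⟨fun hx => ?_, fun ⟨h1, h2⟩ => h i j h1 h2⟩⟩
  have hne : i ≠ j := by
    rintro rfl
    exact lt_irrefl _ hx
  exact ⟨(w.rel_total i j).resolve_right fun h' => lt_asymm hx (h j i h' hne.symm), hne⟩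

lemma braidFace_of_mem_chamber {c : ChamberConvention} {w : LinearOrd I} {x y : I → ℝ}
    (hx : x ∈ chamber c w) (hy : y ∈ chamber c w) : y ∈ braidFace x := by
  cases c
  · exact fun i j => (hy i j).trans (hx i j).symm
  · exact fun i j => (hy j i).trans (hx j i).symm

lemma chamber_nonempty [Finite I] (c : ChamberConvention) (w : LinearOrd I) :
    (chamber c w).Nonempty := by
  suffices h : (chamber .increasing w).Nonempty by
    cases c
    · exact h
    · obtain ⟨x, hx⟩ := h
      exact ⟨-x, mem_chamber_decreasing.2 (by rwa [neg_neg])⟩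
  -- The coordinate of i is its position in w, counted from 1.
  refine ⟨fun i => ({j | w.1 j i} : Set I).ncard, mem_chamber_increasing.2 fun i j hij hne => ?_⟩
  refine Nat.cast_lt.2 (Set.ncard_lt_ncard ⟨fun l hl => w.rel_trans hl hij, fun h => ?_⟩)
  exact hne (w.rel_antisymm hij (h (w.2.refl j)))

lemma isOpen_chamber [Finite I] (c : ChamberConvention) (w : LinearOrd I) :
    IsOpen (chamber c w) := by
  have h : IsOpen (chamber .increasing w) := by
    have : chamber .increasing w = ⋂ (i) (j) (_ : w.1 i j) (_ : i ≠ j), {x | x i < x j} := by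
      ext x
      simp [mem_chamber_increasing]
    rw [this]
    exact isOpen_iInter_of_finite fun i => isOpen_iInter_of_finite fun j =>
      isOpen_iInter_of_finite fun _ => isOpen_iInter_of_finite fun _ =>
        isOpen_lt (continuous_apply i) (continuous_apply j)
  cases c
  · exact h
  · have : chamber .decreasing w = Neg.neg ⁻¹' chamber .increasing w :=
      Set.ext fun x => mem_chamber_decreasing
    rw [this]
    exact h.preimage continuous_neg

lemma comp_mem_chamber {c : ChamberConvention} {f : J → I} (hf : Function.Injective f)
    {w : LinearOrd I} {x : I → ℝ} (hx : x ∈ chamber c w) : x ∘ f ∈ chamber c (w.comap f hf) := by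
  cases c <;> exact fun i j => (hx _ _).trans (and_congr_right fun _ => hf.ne_iff)

/-- Vectors in the chambers of the two parts of a linear order with a given initial segment
can be glued after translating one of them. -/
lemma exists_add_mem_chamber [Finite I] [Finite J] (c : ChamberConvention)
    {v : LinearOrd (I ⊕ J)} (hv : v.LeftInitial) {x : I → ℝ} {y : J → ℝ}
    (hx : x ∈ chamber c v.left) (hy : y ∈ chamber c v.right) :
    ∃ C : ℝ, Sum.elim x (fun j => y j + C) ∈ chamber c v := by
  have key : ∀ {x : I → ℝ} {y : J → ℝ}, x ∈ chamber .increasing v.left →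
      y ∈ chamber .increasing v.right →
      ∃ C : ℝ, Sum.elim x (fun j => y j + C) ∈ chamber .increasing v := by
    intro x y hx hy
    -- C bounds all differences between coordinates of x and of y; translating by C + 1 puts J
    -- strictly above I.
    obtain ⟨C, hC⟩ := (Set.finite_range fun t : I × J => x t.1 - y t.2).bddAbove
    refine ⟨C + 1, mem_chamber_increasing.2 ?_⟩
    rintro (i | i) (j | j) h hne
    · exact mem_chamber_increasing.1 hx i j h (by simpa using hne)
    · have := hC ⟨(i, j), rfl⟩
      simp only [Sum.elim_inl, Sum.elim_inr] at this ⊢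
      linarith
    · exact absurd h (hv.not_rel j i)
    · have := mem_chamber_increasing.1 hy i j h (by simpa using hne)
      simpa using this
  cases c
  · exact key hx hy
  · obtain ⟨C, hC⟩ := key (mem_chamber_decreasing.1 hx) (mem_chamber_decreasing.1 hy)
    refine ⟨-C, mem_chamber_decreasing.2 ?_⟩
    convert hC using 1
    ext (i | i) <;> simp [add_comm]

end Chamber

/-! ### Compatible pairs -/

section Compatible

variable {I J : Type u} {c : ChamberConvention}

lemma compatible_iff {w : LinearOrd I} {p : EGP I} :
    Compatible c w p ↔ ∀ x ∈ chamber c w, (face p.1 x).Nonempty :=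
  forall₂_congr fun _ _ => mem_sUnion_normalFan

/-- A chamber lies in a single braid face, so all its functionals have the same maximizers on p. -/
lemma maxFace_chamber {w : LinearOrd I} {p : EGP I} (h : Compatible c w p) {x : I → ℝ}
    (hx : x ∈ chamber c w) : maxFace p.1 (chamber c w) = face p.1 x := by
  ext y
  refine ⟨fun hy => ⟨hy.1, hy.2 x hx⟩, fun hy => ⟨hy.1, fun x' hx' => ?_⟩⟩
  rw [← p.2.face_eq (braidFace_of_mem_chamber hx hx') (compatible_iff.1 h x hx)] at hy
  exact hy.2

variable [Finite I] [Finite J]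

lemma Compatible.relabel {w : LinearOrd I} {p : EGP I} (h : Compatible c w p) (e : I ≃ J) :
    Compatible c (w.relabel e) (p.relabel e) := by
  refine compatible_iff.2 fun x hx => ?_
  rw [EGP.relabel, face_relabelSet, nonempty_relabelSet]
  refine compatible_iff.1 h _ ?_
  have h1 := comp_mem_chamber e.injective hx
  have h2 : (w.relabel e).comap e e.injective = w :=
    LinearOrd.ext_rel fun i j => by simp [LinearOrd.relabel, LinearOrd.comap, Function.onFun]
  rwa [h2] at h1

/-- A vector in the chamber of a shuffle restricts to vectors in the chambers of w and t, and faces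
of products are products of faces. -/
lemma Compatible.prod {w : LinearOrd I} {p : EGP I} {t : LinearOrd J} {q : EGP J}
    (h : Compatible c w p) (h' : Compatible c t q) {v : LinearOrd (I ⊕ J)}
    (hv : v ∈ shuffles w t) : Compatible c v (p.prod q) := by
  obtain ⟨rfl, rfl⟩ := hv
  refine compatible_iff.2 fun x hx => ?_
  obtain ⟨y, hy⟩ := compatible_iff.1 h _ (comp_mem_chamber Sum.inl_injective hx)
  obtain ⟨z, hz⟩ := compatible_iff.1 h' _ (comp_mem_chamber Sum.inr_injective hx)
  rw [EGP.prod, face_prodSet]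
  exact ⟨Sum.elim y z, hy, hz⟩

/-- A functional bounded above on p is bounded above on the nonempty face p|I × p/I, and its
maximizers there split into maximizers on the factors. Neither I being initial in v nor the chamber
convention matters here. -/
lemma Compatible.face_restr_contr_nonempty {v : LinearOrd (I ⊕ J)} {p : EGP (I ⊕ J)}
    (h : Compatible c v p) (hp : p.BoundedLeft) {x : I ⊕ J → ℝ} (hx : x ∈ chamber c v) :
    (face (restrSet p.1) (x ∘ Sum.inl)).Nonempty ∧
      (face (contrSet p.1) (x ∘ Sum.inr)).Nonempty := by
  obtain ⟨y, hy⟩ := compatible_iff.1 h x hx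
  obtain ⟨z, hz⟩ := face_nonempty_of_le (p.2.1.face _ hp) hp x (dot x y) fun z hz => hy.2 z hz.1
  rw [p.2.face_eq_prodSet, face_prodSet] at hz
  exact ⟨⟨_, hz.1⟩, ⟨_, hz.2⟩⟩

lemma Compatible.restr {v : LinearOrd (I ⊕ J)} {p : EGP (I ⊕ J)} (h : Compatible c v p)
    (hv : v.LeftInitial) (hp : p.BoundedLeft) : Compatible c v.left (p.restr hp) := by
  refine compatible_iff.2 fun x hx => ?_
  obtain ⟨y, hy⟩ := chamber_nonempty c v.right
  obtain ⟨C, hC⟩ := exists_add_mem_chamber c hv hx hy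
  have h1 := (h.face_restr_contr_nonempty hp hC).1
  rwa [Sum.elim_comp_inl] at h1

lemma Compatible.contr {v : LinearOrd (I ⊕ J)} {p : EGP (I ⊕ J)} (h : Compatible c v p)
    (hv : v.LeftInitial) (hp : p.BoundedLeft) : Compatible c v.right (p.contr hp) := by
  refine compatible_iff.2 fun y hy => ?_
  obtain ⟨x, hx⟩ := chamber_nonempty c v.left
  obtain ⟨C, hC⟩ := exists_add_mem_chamber c hv hx hy
  have h1 := (h.face_restr_contr_nonempty hp hC).2
  rw [Sum.elim_comp_inr] at h1
  -- The gluing translated y by the constant C; this does not leave the braid face of y, so the face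
  -- of p/I is unchanged.
  have h2 := (p.contr hp).2.face_eq (x := fun j => y j + C) (y := y) (fun i j => by simp) h1
  rw [h2]
  exact h1

lemma eq_zero_of_dot_self {x : I → ℝ} (h : dot x x = 0) : x = 0 := by
  cases nonempty_fintype I
  rw [dot, finsum_eq_sum_of_fintype, Finset.sum_eq_zero_iff_of_nonneg fun i _ =>
    mul_self_nonneg _] at h
  exact funext fun i => mul_self_eq_zero.1 (h i (Finset.mem_univ i))

/-- Two maximizers y and z have the same value under every functional in σ. By openness x + ε (y -
z) stays in σ for small ε > 0, and comparing with x gives (y - z) · (y - z) = 0. -/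
lemma maxFace_subsingleton (p : Set (I → ℝ)) {σ : Set (I → ℝ)} (hσ : IsOpen σ)
    (hne : σ.Nonempty) : (maxFace p σ).Subsingleton := by
  intro y hy z hz
  obtain ⟨x, hx⟩ := hne
  have h0 : ∀ x ∈ σ, dot x (y - z) = 0 := fun x hx => by
    have h1 : dot x y = dot x z := le_antisymm (hz.2 x hx y hy.1) (hy.2 x hx z hz.1)
    have h2 := dot_add x (y - z) z
    rw [sub_add_cancel] at h2
    linarith
  have hcont : Continuous fun ε : ℝ => x + ε • (y - z) := by fun_prop
  have hev : ∀ᶠ ε : ℝ in nhds 0, x + ε • (y - z) ∈ σ :=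
    hcont.continuousAt.eventually_mem (hσ.mem_nhds (by simpa using hx))
  obtain ⟨ε, hε, hpos⟩ := ((hev.filter_mono nhdsWithin_le_nhds).and
    (self_mem_nhdsWithin (s := Set.Ioi (0 : ℝ)))).exists
  have h1 := h0 _ hε
  rw [add_dot, smul_dot, h0 x hx, zero_add] at h1
  exact sub_eq_zero.1 (eq_zero_of_dot_self ((mul_eq_zero.1 h1).resolve_left (ne_of_gt hpos)))

/-- The value at an interior point of a segment is a weighted mean of the values at the ends, so if
it is maximal then both ends are maximizers and equal the only one. -/
lemma mem_extremePoints_of_face_eq {p : Set (I → ℝ)} {x y : I → ℝ} (h : face p x = {y}) :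
    y ∈ Set.extremePoints ℝ p := by
  have hy : y ∈ face p x := h ▸ rfl
  refine ⟨hy.1, fun a ha b hb hab => ?_⟩
  obtain ⟨s, t, hs, ht, hst, rfl⟩ := hab
  have h1 := hy.2 a ha
  have h2 := hy.2 b hb
  rw [← Set.mem_singleton_iff, ← h]
  refine ⟨ha, fun z hz => (hy.2 z hz).trans ?_⟩
  rw [dot_add, dot_smul, dot_smul] at h1 h2 ⊢
  obtain rfl : s = 1 - t := by linarith
  have h3 : dot x b ≤ dot x a := le_of_mul_le_mul_left (by linarith) hs
  nlinarith

lemma Compatible.exists_maxFace_eq {w : LinearOrd I} {p : EGP I} (h : Compatible c w p) :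
    ∃ x ∈ Set.extremePoints ℝ p.1, maxFace p.1 (chamber c w) = {x} := by
  obtain ⟨x, hx⟩ := chamber_nonempty c w
  have h1 := maxFace_chamber h hx
  obtain ⟨y, hy⟩ := compatible_iff.1 h x hx
  have h2 := (maxFace_subsingleton p.1 (isOpen_chamber c w)
    (chamber_nonempty c w)).eq_singleton_of_mem (h1 ▸ hy)
  exact ⟨y, mem_extremePoints_of_face_eq (h1 ▸ h2), h2⟩

end Compatible

/-! ### The Hopf submonoid `OGP₊` and the theorem -/

lemma tensor_eq {k : Type v} [Field k] {I : Type u} [Finite I] (w : LinearOrd I) (p : EGP I) :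
    tensor.{u, v} k w p = (Lstar.{u, v} k).pure (GPplus k) I (Lstar.of k w) (GPplus.of k p) := rfl

/-- `OGP₊` is a Hopf submonoid of `L* × GP₊`. -/
theorem isHopfSubmonoid_OGPplus (k : Type v) [Field k] (c : ChamberConvention) :
    IsHopfSubmonoid ((Lstar.{u, v} k).hadamard (GPplus.{u, v} k))
      (fun I [Finite I] => OGPplus k c I) where
  map_mem e x hx := by
    refine Submodule.span_induction ?_ ?_ ?_ ?_ hx
    · rintro _ ⟨w, p, h, rfl⟩
      rw [tensor_eq, hadamard_map, Lstar.map_of, GPplus.map_of]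
      exact Submodule.subset_span ⟨_, _, h.relabel e, rfl⟩
    · rw [map_zero]
      exact Submodule.zero_mem _
    · intro x y _ _ hx hy
      rw [map_add]
      exact Submodule.add_mem _ hx hy
    · intro a x _ hx
      rw [map_smul]
      exact Submodule.smul_mem _ a hx
  one_mem := Submodule.subset_span ⟨LinearOrd.empty, EGP.point, compatible_iff.2 fun x _ => by
    rw [Subsingleton.elim x 0, face_zero]
    exact EGP.point.2.2.1, rfl⟩
  mul_mem I J _ _ x hx y hy := by
    refine Submodule.span_induction₂ (p := fun x y _ _ =>
      ((Lstar.{u, v} k).hadamard (GPplus.{u, v} k)).mul I J (x ⊗ₜ y) ∈ OGPplus k c (I ⊕ J))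
      ?_ ?_ ?_ ?_ ?_ ?_ ?_ hx hy
    · rintro _ _ ⟨w, p, h, rfl⟩ ⟨t, q, h', rfl⟩
      rw [tensor_eq, tensor_eq, hadamard_mul, Lstar.mul_of, GPplus.mul_of, Lstar.setSum, map_sum,
        LinearMap.sum_apply]
      -- The product is the sum of v ⊗ (p × q) over the shuffles v, and each term is compatible.
      exact Submodule.sum_mem _ fun v hv =>
        Submodule.subset_span ⟨v, _, h.prod h' (by simpa using hv), rfl⟩
    · intro y _
      rw [TensorProduct.zero_tmul, map_zero]
      exact Submodule.zero_mem _
    · intro x _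
      rw [TensorProduct.tmul_zero, map_zero]
      exact Submodule.zero_mem _
    · intro x y z _ _ _ h1 h2
      rw [TensorProduct.add_tmul, map_add]
      exact Submodule.add_mem _ h1 h2
    · intro x y z _ _ _ h1 h2
      rw [TensorProduct.tmul_add, map_add]
      exact Submodule.add_mem _ h1 h2
    · intro a x y _ _ h
      rw [← TensorProduct.smul_tmul', map_smul]
      exact Submodule.smul_mem _ a h
    · intro a x y _ _ h
      rw [TensorProduct.tmul_smul, map_smul]
      exact Submodule.smul_mem _ a h
  comul_mem I J _ _ x hx := by
    refine Submodule.span_induction ?_ ?_ ?_ ?_ hx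
    · rintro _ ⟨v, p, h, rfl⟩
      rw [tensor_eq, hadamard_comul]
      by_cases hv : v.LeftInitial
      · by_cases hp : p.BoundedLeft
        · rw [Lstar.comul_of hv, GPplus.comul_of hp, TensorProduct.map₂_apply_tmul]
          exact ⟨⟨_, Submodule.subset_span ⟨_, _, h.restr hv hp, rfl⟩⟩ ⊗ₜ
            ⟨_, Submodule.subset_span ⟨_, _, h.contr hv hp, rfl⟩⟩, rfl⟩
        · rw [GPplus.comul_of_not hp, map_zero]
          exact Submodule.zero_mem _
      · rw [Lstar.comul_of_not hv, map_zero, LinearMap.zero_apply]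
        exact Submodule.zero_mem _
    · rw [map_zero]
      exact Submodule.zero_mem _
    · intro x y _ _ hx hy
      rw [map_add]
      exact Submodule.add_mem _ hx hy
    · intro a x _ hx
      rw [map_smul]
      exact Submodule.smul_mem _ a hx

end OrderedGP

end

theorem theorem3p3 (k : Type v) [Field k] :
    OrderedGP.IsHopfMonoid
        ((OrderedGP.Lstar.{u, v} k).hadamard (OrderedGP.GPplus.{u, v} k)) ∧
      ∀ c : OrderedGP.ChamberConvention,
        OrderedGP.IsHopfSubmonoid
            ((OrderedGP.Lstar.{u, v} k).hadamard (OrderedGP.GPplus.{u, v} k))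
            (fun I [Finite I] => OrderedGP.OGPplus k c I) ∧
          ∀ (I : Type u) [Finite I] (w : OrderedGP.LinearOrd I) (p : OrderedGP.EGP I),
            OrderedGP.Compatible c w p →
              ∃ x ∈ Set.extremePoints ℝ p.1,
                OrderedGP.maxFace p.1 (OrderedGP.chamber c w) = {x} :=
  ⟨(OrderedGP.isHopfMonoid_Lstar k).hadamard (OrderedGP.isHopfMonoid_GPplus k), fun c =>
    ⟨OrderedGP.isHopfSubmonoid_OGPplus k c, fun _ _ _ _ h => h.exists_maxFace_eq⟩⟩
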